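/- **Conventions.** $\mathbb K$ is a field. "Epimorphism", written $\twoheadrightarrow$, means *extremal* epimorphism: an epimorphism that does not factor through any proper subobject of its target. A category $\mathcal A$ is *regular* (in the sense of Knop) if it has a terminal object $\mathbf 1$; all morphisms have images; the pullback $x\times_z y$ exists for every cospan $x\to z\leftarrow y$ that can be completed to a commutative square, and also for every cospan with $x\twoheadrightarrow z$ an epimorphism; and epimorphisms are stable under pullback. (Other pullbacks and products need not exist.) A *degree function* $\delta$ on $\mathcal A$ assigns to each epimorphism $e$ an element $\delta(e)\in\mathbb K$ such that $\delta(\mathrm{id}_x)=1$, $\delta(e'e)=\delta(e')\delta(e)$ for composable epimorphisms, and $\delta(e')=\delta(e)$ if $e'$ is a pullback of $e$. A *relation* between $x$ and $y$ is a subobject $r\subset x\times y$, i.e. an isomorphism class of jointly monic pairs $x\leftarrow r\to y$ (there is none if $x\times y$ does not exist). $\mathcal T^0(\mathcal A,\delta)$ is the $\mathbb K$-linear category whose objects $[x]$ are the objects of $\mathcal A$ and whose morphisms $[x]\to[y]$ are the formal $\mathbb K$-linear combinations of relations $\langle r\rangle$, $r\subset x\times y$, with bilinear composition such that for $r\subset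 x\times y$, $s\subset y\times z$: $\langle s\rangle\circ\langle r\rangle=\delta(e)\langle s\star r\rangle$ if $r\times_y s$ exists, where $s\star r=\mathrm{im}(r\times_y s\to x\times z)$ and $e:r\times_y s\twoheadrightarrow s\star r$, and $\langle s\rangle\circ\langle r\rangle=0$ otherwise. $\Gamma_{\mathcal A}:\mathcal A\to\mathcal T^0(\mathcal A,\delta)$ sends $x$ to $[x]$ and $f$ to $\langle\text{graph of }f\rangle$. $\mathcal T(\mathcal A,\delta)$ is the additive Karoubi envelope of $\mathcal T^0(\mathcal A,\delta)$ (formal finite direct sums, then formal direct factors). It is symmetric monoidal: $[x]\otimes[y]=[x\times y]$ and $\langle r\rangle\otimes\langle s\rangle=\langle r\times s\rangle$, each understood to be $0$ when the product in question ($x\times y$, resp. $r\times s$) does not exist; the unit is $[\mathbf 1]$ and the structure isomorphisms are those of the cartesian product. If $\mathcal A$ has binary products, the same formulas make $\mathcal T^0(\mathcal A,\delta)$ symmetric monoidal. **Statement.** Let $\mathcal A,\mathcal A'$ be regular categories with degree functions $\delta,\delta'$ with values in $\mathbb K$, and let $F:\mathcal A\to\mathcal A'$ be a functor that * preserves the degree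 functions: if $e$ is an epimorphism, so is $F(e)$, and $\delta'(F(e))=\delta(e)$; * preserves pullbacks, including their non-existence: for every cospan $x\to z\leftarrow y$ in $\mathcal A$, if $x\times_z y$ exists, then $F$ carries the pullback square to a pullback square; and if $F(x)\times_{F(z)}F(y)$ exists, then $x\times_z y$ exists. (The last clause is automatic if $\mathcal A$ has all pullbacks.) Then: 1. For every relation $r\subset x\times y$ the pair $F(x)\leftarrow F(r)\to F(y)$ is jointly monic, i.e. $F(r)$ is a relation between $F(x)$ and $F(y)$, and there is a $\mathbb K$-linear functor $\overline F:\mathcal T^0(\mathcal A,\delta)\to\mathcal T^0(\mathcal A',\delta')$ with $\overline F([x])=[F(x)]$ and $\overline F(\langle r\rangle)=\langle F(r)\rangle$. 2. There is a natural isomorphism $\Gamma_{\mathcal A'}\circ F\cong\overline F\circ\Gamma_{\mathcal A}$. 3. $\overline F$ extends (up to natural isomorphism) to a $\mathbb K$-linear functor $\mathcal T(\mathcal A,\delta)\to\mathcal T(\mathcal A',\delta')$. If $F(\mathbf 1)$ is a terminal object of $\mathcal A'$ (equivalently, if $F$ preserves all finite limits that exist in $\mathcal A$), then this extension is symmetric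 monoidal; and if moreover $\mathcal A$ and $\mathcal A'$ have binary products, then $\overline F:\mathcal T^0(\mathcal A,\delta)\to\mathcal T^0(\mathcal A',\delta')$ itself is symmetric monoidal. -/

import Mathlib

open CategoryTheory CategoryTheory.Limits

namespace Knop

universe w v u v' u'

/-- Knop's (possibly incomplete) regular categories. "Epimorphism" means extremal epimorphism: a
morphism which does not factor through a proper subobject of its target. The pullback of
`x ⟶ z ⟵ y` is only required to exist when these two arrows can be completed to a commutative
square, or when one of them is an extremal epimorphism. -/
class RegularCategory (A : Type u) [Category.{v} A] : Prop where
  hasTerminal : HasTerminal A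
  hasImages : HasImages A
  hasPullback_of_commSq {w x y z : A} {p : w ⟶ x} {q : w ⟶ y} {f : x ⟶ z} {g : y ⟶ z} :
    p ≫ f = q ≫ g → HasPullback f g
  hasPullback_of_extremalEpi {x y z : A} (e : x ⟶ z) (g : y ⟶ z) : ExtremalEpi e → HasPullback e g
  extremalEpi_of_isPullback {w x y z : A} {p : w ⟶ x} {q : w ⟶ y} {e : x ⟶ z} {g : y ⟶ z} :
    IsPullback p q e g → ExtremalEpi e → ExtremalEpi q

attribute [instance] RegularCategory.hasTerminal RegularCategory.hasImages

/-- A degree function: a multiplicative, pullback-invariant function on the (extremal)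
epimorphisms of `A` with values in `K`. -/
structure DegreeFunction (K : Type w) [Field K] (A : Type u) [Category.{v} A] where
  deg {x y : A} (e : x ⟶ y) : ExtremalEpi e → K
  deg_id (x : A) (h : ExtremalEpi (𝟙 x)) : deg (𝟙 x) h = 1
  deg_comp {x y z : A} (e : x ⟶ y) (e' : y ⟶ z) (h : ExtremalEpi e) (h' : ExtremalEpi e')
    (h'' : ExtremalEpi (e ≫ e')) : deg (e ≫ e') h'' = deg e' h' * deg e h
  deg_pullback {w x y z : A} {p : w ⟶ x} {q : w ⟶ y} {e : x ⟶ z} {g : y ⟶ z}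
    (sq : IsPullback p q e g) (h : ExtremalEpi e) (h' : ExtremalEpi q) : deg q h' = deg e h

section Basic

variable {A : Type u} [Category.{v} A]

/-- The pair `x ⟵ w ⟶ y` is jointly monic: it exhibits `w` as a subobject of `x × y`. -/
def JM {w x y : A} (f : w ⟶ x) (g : w ⟶ y) : Prop :=
  ∀ ⦃t : A⦄ (a b : t ⟶ w), a ≫ f = b ≫ f → a ≫ g = b ≫ g → a = b

/-- A representative of a relation: a jointly monic pair `x ⟵ r ⟶ y`. -/
structure RelSpan (x y : A) where
  apex : A
  fst : apex ⟶ x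
  snd : apex ⟶ y
  jm : JM fst snd

/-- Two jointly monic pairs represent the same relation if they are isomorphic over `x` and `y`. -/
instance RelSpan.setoid (x y : A) : Setoid (RelSpan x y) where
  r R S := ∃ i : R.apex ≅ S.apex, i.hom ≫ S.fst = R.fst ∧ i.hom ≫ S.snd = R.snd
  iseqv :=
    { refl := fun R => ⟨Iso.refl _, by simp, by simp⟩
      symm := by
        rintro R S ⟨i, h, h'⟩
        exact ⟨i.symm, by simp [← h], by simp [← h']⟩
      trans := by
        rintro R S T ⟨i, h, h'⟩ ⟨j, k, k'⟩
        exact ⟨i ≪≫ j, by simp [h, k], by simp [h', k']⟩ }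

/-- A relation between `x` and `y`, i.e. a subobject of `x × y` (there is none if the product
does not exist; in a regular category the product exists as soon as some pair
`x ⟵ w ⟶ y` does). -/
def Rel (x y : A) : Type (max u v) := Quotient (RelSpan.setoid x y)

/-- The relation given by a jointly monic pair. -/
def Rel.mk {w x y : A} (f : w ⟶ x) (g : w ⟶ y) (h : JM f g) : Rel x y :=
  Quotient.mk _ ⟨w, f, g, h⟩

/-- A representative of a relation. -/
noncomputable def Rel.rep {x y : A} (r : Rel x y) : RelSpan x y := Quotient.out r

theorem Rel.mk_rep {x y : A} (r : Rel x y) : Rel.mk r.rep.fst r.rep.snd r.rep.jm = r :=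
  Quotient.out_eq r

theorem Rel.mk_eq {x y w w' : A} {f : w ⟶ x} {g : w ⟶ y} {h : JM f g} {f' : w' ⟶ x} {g' : w' ⟶ y}
    {h' : JM f' g'} (i : w ⟶ w') [IsIso i] (h1 : i ≫ f' = f) (h2 : i ≫ g' = g) :
    Rel.mk f g h = Rel.mk f' g' h' :=
  Quotient.sound ⟨asIso i, h1, h2⟩

theorem Rel.mk_exact {x y w w' : A} {f : w ⟶ x} {g : w ⟶ y} {h : JM f g} {f' : w' ⟶ x}
    {g' : w' ⟶ y} {h' : JM f' g'} (H : Rel.mk f g h = Rel.mk f' g' h') :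
    ∃ i : w ≅ w', i.hom ≫ f' = f ∧ i.hom ≫ g' = g := Quotient.exact H

theorem jm_id_left {x y : A} (f : x ⟶ y) : JM (𝟙 x) f := fun t a b h _ => by
  rwa [Category.comp_id, Category.comp_id] at h

/-- The graph of a morphism. -/
def Rel.graph {x y : A} (f : x ⟶ y) : Rel x y := Rel.mk (𝟙 x) f (jm_id_left f)

theorem extremalEpi_of_isIso {x y : A} (f : x ⟶ y) [IsIso f] : ExtremalEpi f := inferInstance

theorem extremalEpi_of_comp {x y z : A} (f : x ⟶ y) (g : y ⟶ z) (h : ExtremalEpi (f ≫ g)) :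
    ExtremalEpi g :=
  have : Epi g := epi_of_epi f g
  { isIso := fun {Z} p i fac _ => ExtremalEpi.isIso (f ≫ g) (f ≫ p) i (by simp [fac]) }

/-- `x ⟵ p ⟶ y` is a product diagram. -/
structure IsProd {p x y : A} (a : p ⟶ x) (b : p ⟶ y) : Prop where
  jm : JM a b
  exists_lift : ∀ ⦃t : A⦄ (f : t ⟶ x) (g : t ⟶ y), ∃ l : t ⟶ p, l ≫ a = f ∧ l ≫ b = g

theorem isProd_prod (x y : A) [HasBinaryProduct x y] :
    IsProd (prod.fst : x ⨯ y ⟶ x) (prod.snd : x ⨯ y ⟶ y) where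
  jm t a b h1 h2 := by
    apply prod.hom_ext
    · exact h1
    · exact h2
  exists_lift t f g := ⟨prod.lift f g, prod.lift_fst f g, prod.lift_snd f g⟩

variable [RegularCategory A]

theorem extremalEpi_comp {x y z : A} (f : x ⟶ y) (g : y ⟶ z) (hf : ExtremalEpi f)
    (hg : ExtremalEpi g) : ExtremalEpi (f ≫ g) :=
  have := epi_comp f g
  { isIso := fun {Z} p i fac _ => by
      have := RegularCategory.hasPullback_of_commSq (f := i) (g := g) fac
      have h1 : IsIso (pullback.snd i g) :=
        ExtremalEpi.isIso f (pullback.lift p f fac) (pullback.snd i g) (pullback.lift_snd _ _ _)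
      exact ExtremalEpi.isIso g (inv (pullback.snd i g) ≫ pullback.fst i g) i
        (by rw [Category.assoc, pullback.condition, IsIso.inv_hom_id_assoc]) }

theorem hasProd {w x y : A} (f : w ⟶ x) (g : w ⟶ y) : HasBinaryProduct x y := by
  have := RegularCategory.hasPullback_of_commSq (A := A) (p := f) (q := g)
    (f := terminal.from x) (g := terminal.from y) (by ext)
  exact ⟨_, isProductOfIsTerminalIsPullback _ _ _ _ terminalIsTerminal
    (pullbackIsPullback (terminal.from x) (terminal.from y))⟩

theorem exists_isPullback {w x y z : A} {p : w ⟶ x} {q : w ⟶ y} {f : x ⟶ z} {g : y ⟶ z}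
    (h : p ≫ f = q ≫ g) : ∃ (P : A) (p' : P ⟶ x) (q' : P ⟶ y), IsPullback p' q' f g :=
  have := RegularCategory.hasPullback_of_commSq h
  ⟨_, _, _, IsPullback.of_hasPullback f g⟩

theorem exists_isProd {w x y : A} (f : w ⟶ x) (g : w ⟶ y) :
    ∃ (p : A) (a : p ⟶ x) (b : p ⟶ y), IsProd a b :=
  have := hasProd f g
  ⟨_, _, _, isProd_prod x y⟩

/-- Diagonal filling of an extremal epimorphism against a jointly monic pair. -/
theorem fill {w r s x y : A} (e : w ⟶ r) (he : ExtremalEpi e) (h : w ⟶ s) {a : r ⟶ x} {b : r ⟶ y}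
    {c : s ⟶ x} {d : s ⟶ y} (hcd : JM c d) (h1 : e ≫ a = h ≫ c) (h2 : e ≫ b = h ≫ d) :
    ∃ l : r ⟶ s, e ≫ l = h ∧ l ≫ c = a ∧ l ≫ d = b := by
  obtain ⟨p, p1, p2, hp⟩ := exists_isProd a b
  obtain ⟨ab, ha, hb⟩ := hp.exists_lift a b
  obtain ⟨cd, hc, hd⟩ := hp.exists_lift c d
  have hm : Mono cd := ⟨fun u v huv => hcd u v
    (by rw [← hc, reassoc_of% huv]) (by rw [← hd, reassoc_of% huv])⟩
  obtain ⟨q, q1, q2, hq⟩ := exists_isPullback (p := e) (q := h) (f := ab) (g := cd)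
    (hp.jm _ _ (by simp [ha, hc, h1]) (by simp [hb, hd, h2]))
  have hq1 : Mono q1 := ⟨fun u v huv => hq.hom_ext huv (by
    rw [← cancel_mono cd, Category.assoc, Category.assoc, ← hq.w, reassoc_of% huv])⟩
  have he' : e ≫ ab = h ≫ cd := hp.jm _ _ (by simp [ha, hc, h1]) (by simp [hb, hd, h2])
  have hi : IsIso q1 := ExtremalEpi.isIso e (hq.lift e h he') q1 (hq.lift_fst _ _ _)
  have hw : inv q1 ≫ q2 ≫ cd = ab := by rw [← hq.w, IsIso.inv_hom_id_assoc]
  refine ⟨inv q1 ≫ q2, ?_, ?_, ?_⟩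
  · have h3 : hq.lift e h he' = e ≫ inv q1 := by
      rw [IsIso.eq_comp_inv, hq.lift_fst]
    rw [← Category.assoc, ← h3, hq.lift_snd]
  · rw [← hc, Category.assoc, reassoc_of% hw, ha]
  · rw [← hd, Category.assoc, reassoc_of% hw, hb]

theorem extremalEpi_factorThruImage {x y : A} (f : x ⟶ y) : ExtremalEpi (factorThruImage f) := by
  have key : ∀ {Z : A} (p : x ⟶ Z) (i : Z ⟶ image f) (_ : p ≫ i = factorThruImage f) [Mono i],
      IsIso i := by
    intro Z p i fac _
    let F : MonoFactorisation f := ⟨Z, i ≫ image.ι f, p, by rw [← Category.assoc, fac, image.fac]⟩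
    have h : image.lift F ≫ i = 𝟙 _ := by
      rw [← cancel_mono (image.ι f), Category.assoc, Category.id_comp]
      exact image.lift_fac F
    have : IsSplitEpi i := ⟨⟨⟨_, h⟩⟩⟩
    exact isIso_of_mono_of_isSplitEpi i
  have : Epi (factorThruImage f) := ⟨fun {Z} g h hgh => by
    obtain ⟨p, p1, p2, hp⟩ := exists_isProd g h
    obtain ⟨gh, hg, hh⟩ := hp.exists_lift g h
    obtain ⟨d, hd, hd'⟩ := hp.exists_lift (𝟙 Z) (𝟙 Z)
    have hc : (factorThruImage f ≫ g) ≫ d = factorThruImage f ≫ gh :=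
      hp.jm _ _ (by simp [hd, hg]) (by simp [hd', hh, hgh])
    obtain ⟨q, q1, q2, hq⟩ := exists_isPullback hc
    have hm : Mono q2 := ⟨fun u v huv => hq.hom_ext (by
      have h1 : u ≫ q1 ≫ d = v ≫ q1 ≫ d := by rw [hq.w, reassoc_of% huv]
      simpa [hd] using h1 =≫ p1) huv⟩
    have hi := key (hq.lift _ _ hc) q2 (hq.lift_snd _ _ _)
    have k1 : q1 = q2 ≫ g := by
      have := hq.w =≫ p1
      rwa [Category.assoc, Category.assoc, hd, hg, Category.comp_id] at this
    have k2 : q1 = q2 ≫ h := by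
      have := hq.w =≫ p2
      rwa [Category.assoc, Category.assoc, hd', hh, Category.comp_id] at this
    rw [← cancel_epi q2, ← k1, ← k2]⟩
  exact { isIso := fun p i fac _ => key p i fac }

/-- The image of `w` in `x × y`. -/
theorem exists_image {w x y : A} (f : w ⟶ x) (g : w ⟶ y) :
    ∃ (R : RelSpan x y) (e : w ⟶ R.apex), ExtremalEpi e ∧ e ≫ R.fst = f ∧ e ≫ R.snd = g := by
  obtain ⟨p, p1, p2, hp⟩ := exists_isProd f g
  obtain ⟨l, h1, h2⟩ := hp.exists_lift f g
  refine ⟨⟨image l, image.ι l ≫ p1, image.ι l ≫ p2, ?_⟩, factorThruImage l,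
    extremalEpi_factorThruImage l, by rw [image.fac_assoc, h1], by rw [image.fac_assoc, h2]⟩
  intro t a b h1 h2
  rw [← cancel_mono (image.ι l)]
  exact hp.jm _ _ (by simpa using h1) (by simpa using h2)

end Basic

section Spans

variable {K : Type w} [Field K] {A : Type u} [Category.{v} A] (δ : DegreeFunction K A)

theorem DegreeFunction.deg_isIso {x y : A} (f : x ⟶ y) [IsIso f] (h : ExtremalEpi f) :
    δ.deg f h = 1 := by
  have sq : IsPullback f f (𝟙 y) (𝟙 y) := IsPullback.of_vert_isIso ⟨by simp⟩
  rw [δ.deg_pullback sq inferInstance h, δ.deg_id]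

variable [RegularCategory A]

/-- The combination `δ(e) ⟨im⟩` attached to an arbitrary pair `x ⟵ w ⟶ y`, where `im` is the image
of `w` in `x × y` and `e` is the projection of `w` onto `im`. -/
noncomputable def sp {w x y : A} (f : w ⟶ x) (g : w ⟶ y) : Rel x y →₀ K :=
  let R : RelSpan x y := (exists_image f g).choose
  let e : w ⟶ R.apex := (exists_image f g).choose_spec.choose
  have he : ExtremalEpi e := (exists_image f g).choose_spec.choose_spec.1
  Finsupp.single (Rel.mk R.fst R.snd R.jm) (δ.deg e he)

theorem sp_eq {w r x y : A} {e : w ⟶ r} (he : ExtremalEpi e) {f : r ⟶ x} {g : r ⟶ y} (h : JM f g) :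
    sp δ (e ≫ f) (e ≫ g) = Finsupp.single (Rel.mk f g h) (δ.deg e he) := by
  have key : ∀ (R : RelSpan x y) (d : w ⟶ R.apex) (hd : ExtremalEpi d), d ≫ R.fst = e ≫ f →
      d ≫ R.snd = e ≫ g → (Finsupp.single (Rel.mk R.fst R.snd R.jm) (δ.deg d hd) : Rel x y →₀ K) =
        Finsupp.single (Rel.mk f g h) (δ.deg e he) := by
    intro R d hd h2 h3
    obtain ⟨l, hl, hl1, hl2⟩ := fill d hd e h h2 h3
    obtain ⟨m, hm, hm1, hm2⟩ := fill e he d R.jm h2.symm h3.symm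
    have hlm : l ≫ m = 𝟙 _ := R.jm _ _ (by simp [hl1, hm1]) (by simp [hl2, hm2])
    have hml : m ≫ l = 𝟙 _ := h _ _ (by simp [hl1, hm1]) (by simp [hl2, hm2])
    have hi : IsIso l := ⟨m, hlm, hml⟩
    have hd : δ.deg d hd = δ.deg e he := by
      subst hl
      rw [δ.deg_comp _ l hd inferInstance he, δ.deg_isIso l, one_mul]
    rw [hd, Rel.mk_eq l hl1 hl2]
  obtain ⟨h2, h3⟩ := (exists_image (e ≫ f) (e ≫ g)).choose_spec.choose_spec.2
  exact key _ _ _ h2 h3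

theorem sp_jm {r x y : A} {f : r ⟶ x} {g : r ⟶ y} (h : JM f g) :
    sp δ f g = Finsupp.single (Rel.mk f g h) 1 := by
  have := sp_eq δ (e := 𝟙 r) inferInstance h
  simpa [δ.deg_id] using this

theorem sp_comp_epi {w w' x y : A} {e : w' ⟶ w} (he : ExtremalEpi e) (f : w ⟶ x) (g : w ⟶ y) :
    sp δ (e ≫ f) (e ≫ g) = δ.deg e he • sp δ f g := by
  obtain ⟨R, d, hd, rfl, rfl⟩ := exists_image f g
  rw [← Category.assoc, ← Category.assoc, sp_eq δ hd R.jm,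
    sp_eq δ (extremalEpi_comp _ _ he hd) R.jm, Finsupp.smul_single, smul_eq_mul,
    δ.deg_comp e d he hd, mul_comm]

theorem single_eq_sp {x y : A} (r : Rel x y) :
    (Finsupp.single r 1 : Rel x y →₀ K) = sp δ r.rep.fst r.rep.snd := by
  rw [sp_jm δ r.rep.jm, Rel.mk_rep]

/-- Every pair is (up to the scalar `δ(e)`) a relation. -/
theorem exists_rel {w x y : A} (f : w ⟶ x) (g : w ⟶ y) :
    ∃ (r : Rel x y) (e : w ⟶ r.rep.apex), ExtremalEpi e ∧ e ≫ r.rep.fst = f ∧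
      e ≫ r.rep.snd = g := by
  obtain ⟨R, e, he, h1, h2⟩ := exists_image f g
  obtain ⟨i, hi1, hi2⟩ := Rel.mk_exact (Rel.mk_rep (Rel.mk R.fst R.snd R.jm)).symm
  exact ⟨Rel.mk R.fst R.snd R.jm, e ≫ i.hom, extremalEpi_comp _ _ he inferInstance, by
    rw [Category.assoc, hi1, h1], by rw [Category.assoc, hi2, h2]⟩

open Classical in
/-- The composite of two relations `⟨r⟩ : [x] ⟶ [y]`, `⟨s⟩ : [y] ⟶ [z]`: it is `δ(e) ⟨s ⋆ r⟩` for
`e : r ×_y s ⟶ s ⋆ r = im (r ×_y s ⟶ x × z)` if `r ×_y s` exists, and zero otherwise. -/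
noncomputable def relComp {x y z : A} (r : Rel x y) (s : Rel y z) : Rel x z →₀ K :=
  if _h : HasPullback r.rep.snd s.rep.fst then
    sp δ (pullback.fst r.rep.snd s.rep.fst ≫ r.rep.fst)
      (pullback.snd r.rep.snd s.rep.fst ≫ s.rep.snd)
  else 0

/-- The bilinear extension of the composition of relations. -/
noncomputable def comp (x y z : A) :
    (Rel x y →₀ K) →ₗ[K] (Rel y z →₀ K) →ₗ[K] (Rel x z →₀ K) :=
  Finsupp.linearCombination K fun r => Finsupp.linearCombination K fun s => relComp δ r s

/-- Two linear maps agree if they agree on pairs. -/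
theorem lin_ext {x y : A} {V : Type*} [AddCommMonoid V] [Module K V]
    {φ ψ : (Rel x y →₀ K) →ₗ[K] V}
    (h : ∀ (w : A) (f : w ⟶ x) (g : w ⟶ y), φ (sp δ f g) = ψ (sp δ f g)) : φ = ψ := by
  refine Finsupp.lhom_ext' fun r => LinearMap.ext_ring ?_
  simpa [single_eq_sp δ r] using h _ r.rep.fst r.rep.snd

/-- The composite of two pairs is computed by the pullback. -/
def GoodComp {w w' x y z : A} (f : w ⟶ x) (g : w ⟶ y) (h : w' ⟶ y) (k : w' ⟶ z) : Prop :=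
  (∀ ⦃P : A⦄ (p : P ⟶ w) (q : P ⟶ w'), IsPullback p q g h →
    comp δ x y z (sp δ f g) (sp δ h k) = sp δ (p ≫ f) (q ≫ k)) ∧
  ((∀ ⦃P : A⦄ (p : P ⟶ w) (q : P ⟶ w'), p ≫ g ≠ q ≫ h) →
    comp δ x y z (sp δ f g) (sp δ h k) = 0)

theorem goodComp_left {v w w' x y z : A} {f : w ⟶ x} {g : w ⟶ y} {h : w' ⟶ y} {k : w' ⟶ z}
    (H : GoodComp δ f g h k) {e : v ⟶ w} (he : ExtremalEpi e) :
    GoodComp δ (e ≫ f) (e ≫ g) h k := by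
  rw [GoodComp, sp_comp_epi δ he, map_smul, LinearMap.smul_apply]
  constructor
  · intro P p q hP
    obtain ⟨P', p', q', hP'⟩ := exists_isPullback (p := p ≫ e) (q := q) (f := g) (g := h)
      (by simpa using hP.w)
    obtain ⟨u, hu1, hu2⟩ : ∃ u, u ≫ p' = p ≫ e ∧ u ≫ q' = q :=
      ⟨hP'.lift _ _ (by simpa using hP.w), hP'.lift_fst _ _ _, hP'.lift_snd _ _ _⟩
    have hu : IsPullback p u e p' := IsPullback.of_bot (by rw [hu2]; exact hP) hu1.symm hP'
    have hu' := RegularCategory.extremalEpi_of_isPullback hu he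
    rw [H.1 p' q' hP', ← δ.deg_pullback hu he hu', ← sp_comp_epi δ hu', ← hu2,
      reassoc_of% hu1, Category.assoc]
  · intro hP
    rw [H.2, smul_zero]
    intro P p q hpq
    have := RegularCategory.hasPullback_of_extremalEpi e p he
    refine hP (pullback.fst e p) (pullback.snd e p ≫ q) ?_
    rw [pullback.condition_assoc, hpq, Category.assoc]

theorem goodComp_right {v w w' x y z : A} {f : w ⟶ x} {g : w ⟶ y} {h : w' ⟶ y} {k : w' ⟶ z}
    (H : GoodComp δ f g h k) {e : v ⟶ w'} (he : ExtremalEpi e) :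
    GoodComp δ f g (e ≫ h) (e ≫ k) := by
  rw [GoodComp, sp_comp_epi δ he, map_smul]
  constructor
  · intro P p q hP
    obtain ⟨P', p', q', hP'⟩ := exists_isPullback (p := p) (q := q ≫ e) (f := g) (g := h)
      (by simpa using hP.w)
    obtain ⟨u, hu1, hu2⟩ : ∃ u, u ≫ p' = p ∧ u ≫ q' = q ≫ e :=
      ⟨hP'.lift _ _ (by simpa using hP.w), hP'.lift_fst _ _ _, hP'.lift_snd _ _ _⟩
    have hu : IsPullback q u e q' :=
      IsPullback.of_bot (by rw [hu1]; exact hP.flip) hu2.symm hP'.flip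
    have hu' := RegularCategory.extremalEpi_of_isPullback hu he
    rw [H.1 p' q' hP', ← δ.deg_pullback hu he hu', ← sp_comp_epi δ hu', ← hu1,
      reassoc_of% hu2, Category.assoc]
  · intro hP
    rw [H.2, smul_zero]
    intro P p q hpq
    have := RegularCategory.hasPullback_of_extremalEpi e q he
    refine hP (pullback.snd e q ≫ p) (pullback.fst e q) ?_
    rw [pullback.condition_assoc, ← hpq, Category.assoc]

theorem goodComp {w w' x y z : A} (f : w ⟶ x) (g : w ⟶ y) (h : w' ⟶ y) (k : w' ⟶ z) :
    GoodComp δ f g h k := by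
  obtain ⟨r, e, he, rfl, rfl⟩ := exists_rel f g
  obtain ⟨s, d, hd, rfl, rfl⟩ := exists_rel h k
  refine goodComp_left δ (goodComp_right δ ?_ hd) he
  have key : comp δ x y z (sp δ r.rep.fst r.rep.snd) (sp δ s.rep.fst s.rep.snd) =
      relComp δ r s := by simp [← single_eq_sp, comp]
  rw [GoodComp, key, relComp]
  constructor
  · intro P p q hP
    have hh := hP.hasPullback
    rw [dif_pos hh]
    obtain ⟨i, hi, h1, h2⟩ : ∃ i : P ⟶ pullback r.rep.snd s.rep.fst, IsIso i ∧
        i ≫ pullback.fst _ _ = p ∧ i ≫ pullback.snd _ _ = q :=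
      ⟨hP.isoPullback.hom, inferInstance, hP.isoPullback_hom_fst, hP.isoPullback_hom_snd⟩
    rw [← h1, ← h2, Category.assoc, Category.assoc, sp_comp_epi δ (e := i) inferInstance,
      δ.deg_isIso, one_smul]
  · intro hP
    rw [dif_neg]
    intro hh
    exact hP _ _ (pullback.condition (f := r.rep.snd) (g := s.rep.fst))

theorem comp_sp {P w w' x y z : A} {f : w ⟶ x} {g : w ⟶ y} {h : w' ⟶ y} {k : w' ⟶ z}
    {p : P ⟶ w} {q : P ⟶ w'} (hP : IsPullback p q g h) :
    comp δ x y z (sp δ f g) (sp δ h k) = sp δ (p ≫ f) (q ≫ k) := (goodComp δ f g h k).1 p q hP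

theorem comp_sp_zero {w w' x y z : A} {f : w ⟶ x} {g : w ⟶ y} {h : w' ⟶ y} {k : w' ⟶ z}
    (hP : ∀ ⦃P : A⦄ (p : P ⟶ w) (q : P ⟶ w'), p ≫ g ≠ q ≫ h) :
    comp δ x y z (sp δ f g) (sp δ h k) = 0 := (goodComp δ f g h k).2 hP

theorem comp_assoc_sp {w₁ w₂ w₃ x y z t : A} (f₁ : w₁ ⟶ x) (g₁ : w₁ ⟶ y) (f₂ : w₂ ⟶ y)
    (g₂ : w₂ ⟶ z) (f₃ : w₃ ⟶ z) (g₃ : w₃ ⟶ t) :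
    comp δ x z t (comp δ x y z (sp δ f₁ g₁) (sp δ f₂ g₂)) (sp δ f₃ g₃) =
      comp δ x y t (sp δ f₁ g₁) (comp δ y z t (sp δ f₂ g₂) (sp δ f₃ g₃)) := by
  by_cases H : ∃ (P : A) (a : P ⟶ w₁) (b : P ⟶ w₂) (c : P ⟶ w₃), a ≫ g₁ = b ≫ f₂ ∧
      b ≫ g₂ = c ≫ f₃
  · obtain ⟨P, a, b, c, h1, h2⟩ := H
    obtain ⟨P₁, p₁, q₁, hP₁⟩ := exists_isPullback h1
    obtain ⟨P₂, p₂, q₂, hP₂⟩ := exists_isPullback h2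
    obtain ⟨R, r₁, r₂, hR⟩ := exists_isPullback (f := q₁) (g := p₂)
      (show hP₁.lift a b h1 ≫ q₁ = hP₂.lift b c h2 ≫ p₂ by rw [hP₁.lift_snd, hP₂.lift_fst])
    have e1 : IsPullback r₁ (r₂ ≫ q₂) (q₁ ≫ g₂) f₃ := hR.paste_vert hP₂
    have e2 : IsPullback (r₁ ≫ p₁) r₂ g₁ (p₂ ≫ f₂) := (hR.flip.paste_vert hP₁.flip).flip
    rw [comp_sp δ hP₁, comp_sp δ hP₂, comp_sp δ e1, comp_sp δ e2, Category.assoc, Category.assoc]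
  · push Not at H
    have hl : comp δ x z t (comp δ x y z (sp δ f₁ g₁) (sp δ f₂ g₂)) (sp δ f₃ g₃) = 0 := by
      by_cases h : ∃ (P : A) (a : P ⟶ w₁) (b : P ⟶ w₂), a ≫ g₁ = b ≫ f₂
      · obtain ⟨P, a, b, hab⟩ := h
        obtain ⟨P₁, p₁, q₁, hP₁⟩ := exists_isPullback hab
        rw [comp_sp δ hP₁, comp_sp_zero]
        intro Q p q hpq
        exact H Q (p ≫ p₁) (p ≫ q₁) q (by rw [Category.assoc, hP₁.w, Category.assoc])
          (by rw [← hpq, Category.assoc])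
      · push Not at h
        rw [comp_sp_zero δ h, map_zero, LinearMap.zero_apply]
    have hr : comp δ x y t (sp δ f₁ g₁) (comp δ y z t (sp δ f₂ g₂) (sp δ f₃ g₃)) = 0 := by
      by_cases h : ∃ (P : A) (a : P ⟶ w₂) (b : P ⟶ w₃), a ≫ g₂ = b ≫ f₃
      · obtain ⟨P, a, b, hab⟩ := h
        obtain ⟨P₁, p₁, q₁, hP₁⟩ := exists_isPullback hab
        rw [comp_sp δ hP₁, comp_sp_zero]
        intro Q p q hpq
        exact H Q p (q ≫ p₁) (q ≫ q₁) (by rw [hpq, Category.assoc])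
          (by rw [Category.assoc, hP₁.w, Category.assoc])
      · push Not at h
        rw [comp_sp_zero δ h, map_zero]
    rw [hl, hr]

theorem comp_assoc {x y z t : A} (a : Rel x y →₀ K) (b : Rel y z →₀ K) (c : Rel z t →₀ K) :
    comp δ x z t (comp δ x y z a b) c = comp δ x y t a (comp δ y z t b c) := by
  have hc : ∀ (w₁ w₂ : A) (f₁ : w₁ ⟶ x) (g₁ : w₁ ⟶ y) (f₂ : w₂ ⟶ y) (g₂ : w₂ ⟶ z),
      comp δ x z t (comp δ x y z (sp δ f₁ g₁) (sp δ f₂ g₂)) =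
        comp δ x y t (sp δ f₁ g₁) ∘ₗ comp δ y z t (sp δ f₂ g₂) := fun _ _ _ _ _ _ =>
    lin_ext δ fun _ _ _ => comp_assoc_sp δ _ _ _ _ _ _
  have hb : ∀ (w₁ : A) (f₁ : w₁ ⟶ x) (g₁ : w₁ ⟶ y),
      (comp δ x z t).flip c ∘ₗ comp δ x y z (sp δ f₁ g₁) =
        comp δ x y t (sp δ f₁ g₁) ∘ₗ (comp δ y z t).flip c := fun _ _ _ =>
    lin_ext δ fun _ _ _ => LinearMap.congr_fun (hc _ _ _ _ _ _) c
  have ha : (comp δ x z t).flip c ∘ₗ (comp δ x y z).flip b =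
      (comp δ x y t).flip (comp δ y z t b c) :=
    lin_ext δ fun _ _ _ => LinearMap.congr_fun (hb _ _ _) b
  exact LinearMap.congr_fun ha a

theorem comp_sp_graph {w x y z : A} (f : w ⟶ x) (g : w ⟶ y) (h : y ⟶ z) :
    comp δ x y z (sp δ f g) (sp δ (𝟙 y) h) = sp δ f (g ≫ h) := by
  rw [comp_sp δ (IsPullback.of_id_fst : IsPullback (𝟙 w) g g (𝟙 y)), Category.id_comp]

theorem id_comp_sp {w x y : A} (f : w ⟶ x) (g : w ⟶ y) :
    comp δ x x y (sp δ (𝟙 x) (𝟙 x)) (sp δ f g) = sp δ f g := by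
  rw [comp_sp δ (IsPullback.of_id_snd : IsPullback f (𝟙 w) (𝟙 x) f), Category.comp_id,
    Category.id_comp]

theorem id_comp' {x y : A} (a : Rel x y →₀ K) : comp δ x x y (sp δ (𝟙 x) (𝟙 x)) a = a :=
  LinearMap.congr_fun (lin_ext δ (ψ := LinearMap.id) fun _ f g => id_comp_sp δ f g) a

theorem comp_id' {x y : A} (a : Rel x y →₀ K) : comp δ x y y a (sp δ (𝟙 y) (𝟙 y)) = a :=
  LinearMap.congr_fun (lin_ext δ (φ := (comp δ x y y).flip (sp δ (𝟙 y) (𝟙 y)))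
    (ψ := LinearMap.id) fun _ f g => by
      simpa using comp_sp_graph δ f g (𝟙 y)) a

end Spans

/-- The objects `[x]` of the category `T⁰(A, δ)` are the objects of `A`. -/
structure T0 {K : Type w} [Field K] {A : Type u} [Category.{v} A] (_δ : DegreeFunction K A) where
  of ::
  obj : A

section T0

variable {K : Type w} [Field K] {A : Type u} [Category.{v} A] [RegularCategory A]
  (δ : DegreeFunction K A)

/-- The morphisms `[x] ⟶ [y]` of `T⁰(A, δ)` are the formal linear combinations of relations. -/
noncomputable instance T0.category : Category.{max u v w} (T0 δ) where
  Hom x y := Rel x.obj y.obj →₀ K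
  id x := Finsupp.single (Rel.graph (𝟙 x.obj)) 1
  comp {x y z} a b := comp δ x.obj y.obj z.obj a b
  id_comp a := by rw [Rel.graph, ← sp_jm δ]; exact id_comp' δ a
  comp_id a := by rw [Rel.graph, ← sp_jm δ]; exact comp_id' δ a
  assoc a b c := comp_assoc δ a b c

noncomputable instance T0.preadditive : Preadditive (T0 δ) where
  homGroup x y := inferInstanceAs (AddCommGroup (Rel x.obj y.obj →₀ K))
  add_comp x y z a b c := LinearMap.map_add₂ (comp δ x.obj y.obj z.obj) a b c
  comp_add x y z a b c := (comp δ x.obj y.obj z.obj a).map_add b c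

noncomputable instance T0.linear : Linear K (T0 δ) where
  homModule x y := inferInstanceAs (Module K (Rel x.obj y.obj →₀ K))
  smul_comp x y z c a b := LinearMap.map_smul₂ (comp δ x.obj y.obj z.obj) c a b
  comp_smul x y z a c b := (comp δ x.obj y.obj z.obj a).map_smul c b

variable {δ}

/-- The morphism `⟨r⟩ : [x] ⟶ [y]` given by a relation `r`. -/
noncomputable def T0.rel {x y : A} (r : Rel x y) : (T0.of x : T0 δ) ⟶ T0.of y :=
  (Finsupp.single r 1 : Rel x y →₀ K)

variable (δ)

theorem graph_eq_sp {x y : A} (f : x ⟶ y) : (T0.rel (Rel.graph f) : (T0.of x : T0 δ) ⟶ T0.of y) =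
    sp δ (𝟙 x) f := (sp_jm δ _).symm

/-- The functor `Γ : A ⥤ T⁰(A, δ)`, `x ↦ [x]`, `f ↦ ⟨graph of f⟩`. -/
noncomputable def Γ : A ⥤ T0 δ where
  obj x := T0.of x
  map f := T0.rel (Rel.graph f)
  map_id _ := rfl
  map_comp f g := by
    rw [graph_eq_sp, graph_eq_sp, graph_eq_sp]
    exact (comp_sp_graph δ _ _ _).symm

end T0

end Knop

namespace Knop

universe w v u

section Tens

variable {K : Type w} [Field K] {A : Type u} [Category.{v} A]

section

variable {x x' y y' z t p : A}

theorem plift_fst [HasBinaryProduct x y] (f : t ⟶ x) (g : t ⟶ y) :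
    prod.lift f g ≫ prod.fst = f := prod.lift_fst f g

theorem plift_snd [HasBinaryProduct x y] (f : t ⟶ x) (g : t ⟶ y) :
    prod.lift f g ≫ prod.snd = g := prod.lift_snd f g

theorem comp_plift [HasBinaryProduct x y] (e : p ⟶ t) (f : t ⟶ x) (g : t ⟶ y) :
    e ≫ prod.lift f g = prod.lift (e ≫ f) (e ≫ g) := prod.comp_lift e f g

theorem plift_eta [HasBinaryProduct x y] (f : t ⟶ x ⨯ y) :
    prod.lift (f ≫ prod.fst) (f ≫ prod.snd) = f :=
  (isProd_prod x y).jm _ _ (plift_fst _ _) (plift_snd _ _)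

end

variable [RegularCategory A] (δ : DegreeFunction K A)

open Classical in
/-- The tensor product of two relations `r ⊂ x × y` and `s ⊂ x' × y'`: it is
`⟨r × s⟩ : [x × x'] ⟶ [y × y']` if the product `r × s` exists, and zero otherwise. -/
noncomputable def relTens {x y x' y' : A} [HasBinaryProduct x x'] [HasBinaryProduct y y']
    (r : Rel x y) (s : Rel x' y') : Rel (x ⨯ x') (y ⨯ y') →₀ K :=
  if _h : HasBinaryProduct r.rep.apex s.rep.apex then
    sp δ (prod.lift ((prod.fst : r.rep.apex ⨯ s.rep.apex ⟶ _) ≫ r.rep.fst)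
        ((prod.snd : r.rep.apex ⨯ s.rep.apex ⟶ _) ≫ s.rep.fst))
      (prod.lift ((prod.fst : r.rep.apex ⨯ s.rep.apex ⟶ _) ≫ r.rep.snd)
        ((prod.snd : r.rep.apex ⨯ s.rep.apex ⟶ _) ≫ s.rep.snd))
  else 0

/-- The bilinear extension of the tensor product of relations. -/
noncomputable def tens (x y x' y' : A) [HasBinaryProduct x x'] [HasBinaryProduct y y'] :
    (Rel x y →₀ K) →ₗ[K] (Rel x' y' →₀ K) →ₗ[K] (Rel (x ⨯ x') (y ⨯ y') →₀ K) :=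
  Finsupp.linearCombination K fun r => Finsupp.linearCombination K fun s => relTens δ r s

section

variable {w w' v x y x' y' : A} [HasBinaryProduct x x'] [HasBinaryProduct y y']

/-- The tensor product of two pairs is computed by the product. -/
def GoodTens (f : w ⟶ x) (g : w ⟶ y) (f' : w' ⟶ x') (g' : w' ⟶ y') : Prop :=
  (∀ ⦃P : A⦄ (p : P ⟶ w) (q : P ⟶ w'), IsProd p q →
    tens δ x y x' y' (sp δ f g) (sp δ f' g') =
      sp δ (prod.lift (p ≫ f) (q ≫ f')) (prod.lift (p ≫ g) (q ≫ g'))) ∧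
  ((∀ ⦃P : A⦄ (_ : P ⟶ w) (_ : P ⟶ w'), False) →
    tens δ x y x' y' (sp δ f g) (sp δ f' g') = 0)

theorem goodTens_left {f : w ⟶ x} {g : w ⟶ y} {f' : w' ⟶ x'} {g' : w' ⟶ y'}
    (H : GoodTens δ f g f' g') {e : v ⟶ w} (he : ExtremalEpi e) :
    GoodTens δ (e ≫ f) (e ≫ g) f' g' := by
  rw [GoodTens, sp_comp_epi δ he, map_smul, LinearMap.smul_apply]
  constructor
  · intro P p q hP
    obtain ⟨P', p', q', hP'⟩ := exists_isProd (p ≫ e) q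
    obtain ⟨u, hu1, hu2⟩ := hP'.exists_lift (p ≫ e) q
    have hu : IsPullback p u e p' := by
      refine IsPullback.mk' hu1.symm ?_ ?_
      · intro T a b h1 h2
        exact hP.jm _ _ h1 (by rw [← hu2, reassoc_of% h2])
      · intro T a b hab
        obtain ⟨l, hl1, hl2⟩ := hP.exists_lift a (b ≫ q')
        refine ⟨l, hl1, hP'.jm _ _ ?_ ?_⟩
        · rw [Category.assoc, hu1, reassoc_of% hl1, hab]
        · rw [Category.assoc, hu2, hl2]
    have hu' := RegularCategory.extremalEpi_of_isPullback hu he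
    rw [H.1 p' q' hP', ← δ.deg_pullback hu he hu', ← sp_comp_epi δ hu', comp_plift, comp_plift,
      ← hu2, reassoc_of% hu1, reassoc_of% hu1, Category.assoc, Category.assoc]
  · intro hP
    rw [H.2, smul_zero]
    intro P p q
    have := RegularCategory.hasPullback_of_extremalEpi e p he
    exact hP (pullback.fst e p) (pullback.snd e p ≫ q)

theorem goodTens_right {f : w ⟶ x} {g : w ⟶ y} {f' : w' ⟶ x'} {g' : w' ⟶ y'}
    (H : GoodTens δ f g f' g') {e : v ⟶ w'} (he : ExtremalEpi e) :
    GoodTens δ f g (e ≫ f') (e ≫ g') := by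
  rw [GoodTens, sp_comp_epi δ he, map_smul]
  constructor
  · intro P p q hP
    obtain ⟨P', p', q', hP'⟩ := exists_isProd p (q ≫ e)
    obtain ⟨u, hu1, hu2⟩ := hP'.exists_lift p (q ≫ e)
    have hu : IsPullback q u e q' := by
      refine IsPullback.mk' hu2.symm ?_ ?_
      · intro T a b h1 h2
        exact hP.jm _ _ (by rw [← hu1, reassoc_of% h2]) h1
      · intro T a b hab
        obtain ⟨l, hl1, hl2⟩ := hP.exists_lift (b ≫ p') a
        refine ⟨l, hl2, hP'.jm _ _ ?_ ?_⟩
        · rw [Category.assoc, hu1, hl1]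
        · rw [Category.assoc, hu2, reassoc_of% hl2, hab]
    have hu' := RegularCategory.extremalEpi_of_isPullback hu he
    rw [H.1 p' q' hP', ← δ.deg_pullback hu he hu', ← sp_comp_epi δ hu', comp_plift, comp_plift,
      ← hu1, reassoc_of% hu2, reassoc_of% hu2, Category.assoc, Category.assoc]
  · intro hP
    rw [H.2, smul_zero]
    intro P p q
    have := RegularCategory.hasPullback_of_extremalEpi e q he
    exact hP (pullback.snd e q ≫ p) (pullback.fst e q)

theorem goodTens (f : w ⟶ x) (g : w ⟶ y) (f' : w' ⟶ x') (g' : w' ⟶ y') :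
    GoodTens δ f g f' g' := by
  obtain ⟨r, e, he, rfl, rfl⟩ := exists_rel f g
  obtain ⟨s, d, hd, rfl, rfl⟩ := exists_rel f' g'
  refine goodTens_left δ (goodTens_right δ ?_ hd) he
  have key : tens δ x y x' y' (sp δ r.rep.fst r.rep.snd) (sp δ s.rep.fst s.rep.snd) =
      relTens δ r s := by simp [← single_eq_sp, tens]
  rw [GoodTens, key, relTens]
  constructor
  · intro P p q hP
    have hh := hasProd p q
    rw [dif_pos hh]
    obtain ⟨i, h1, h2⟩ : ∃ i : P ⟶ r.rep.apex ⨯ s.rep.apex, i ≫ prod.fst = p ∧ i ≫ prod.snd = q :=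
      ⟨prod.lift p q, plift_fst _ _, plift_snd _ _⟩
    obtain ⟨j, h3, h4⟩ := hP.exists_lift
      (prod.fst : r.rep.apex ⨯ s.rep.apex ⟶ _) (prod.snd : r.rep.apex ⨯ s.rep.apex ⟶ _)
    have hi : IsIso i := ⟨j, hP.jm _ _ (by simp [h3, h1]) (by simp [h4, h2]),
      (isProd_prod _ _).jm _ _ (by simp [h3, h1]) (by simp [h4, h2])⟩
    simp only [← h1, ← h2, Category.assoc]
    rw [← comp_plift, ← comp_plift, sp_comp_epi δ (e := i) inferInstance, δ.deg_isIso, one_smul]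
  · intro hP
    rw [dif_neg]
    intro hh
    exact hP (prod.fst : r.rep.apex ⨯ s.rep.apex ⟶ _) (prod.snd : r.rep.apex ⨯ s.rep.apex ⟶ _)

end

end Tens

section MatLinear

variable {R : Type w} [Semiring R] {C : Type u} [Category.{v} C] [Preadditive C] [Linear R C]

instance Mat_.linear : Linear R (Mat_ C) where
  homModule M N := inferInstanceAs (Module R (∀ i j, M.X i ⟶ N.X j))
  smul_comp M N P r f g := by
    funext i k
    change ∑ j, (r • f i j) ≫ g j k = r • ∑ j, f i j ≫ g j k
    simp [Finset.smul_sum]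
  comp_smul M N P f r g := by
    funext i k
    change ∑ j, f i j ≫ (r • g j k) = r • ∑ j, f i j ≫ g j k
    simp [Finset.smul_sum]

instance Karoubi.homSMul (P Q : Idempotents.Karoubi C) : SMul R (P ⟶ Q) where
  smul r f := ⟨r • f.f, by simp⟩

instance Karoubi.linear : Linear R (Idempotents.Karoubi C) where
  homModule P Q := Function.Injective.module R (Idempotents.Karoubi.inclusionHom P Q)
    (fun f g h => Idempotents.Karoubi.hom_ext _ _ h) fun _ _ => rfl
  smul_comp P Q S r f g := Idempotents.Karoubi.hom_ext _ _ (Linear.smul_comp _ _ _ r f.f g.f)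
  comp_smul P Q S f r g := Idempotents.Karoubi.hom_ext _ _ (Linear.comp_smul _ _ _ f.f r g.f)

end MatLinear

end Knop

namespace Knop

universe w v u

section MatTensor

variable {K : Type w} [Field K] {A : Type u} [Category.{v} A]

/-- The `t`-points of a finite family of objects of `A`: an index `i` and a morphism from `t`
to the `i`-th object. -/
structure El {δ : DegreeFunction K A} [RegularCategory A] (M : Mat_ (T0 δ)) (t : A) : Type v where
  idx : M.ι
  mor : t ⟶ (M.X idx).obj

variable [RegularCategory A] {δ : DegreeFunction K A} {M N P Q M' N' P' : Mat_ (T0 δ)} {t t' t'' : A}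

/-- Precomposition of a point with a morphism. -/
def El.pre (a : El M t) (p : t' ⟶ t) : El M t' := ⟨a.idx, p ≫ a.mor⟩

theorem El.pre_id (a : El M t) : a.pre (𝟙 t) = a := by
  rw [El.pre, Category.id_comp]

theorem El.pre_pre (a : El M t) (p : t' ⟶ t) (q : t'' ⟶ t') :
    (a.pre p).pre q = a.pre (q ≫ p) := by
  rw [El.pre, El.pre, El.pre, Category.assoc]

theorem El.mk_pre (i : M.ι) (f : t ⟶ (M.X i).obj) :
    El.pre (⟨i, 𝟙 (M.X i).obj⟩ : El M _) f = ⟨i, f⟩ := by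
  rw [El.pre, Category.comp_id]

theorem El.mk_eq {i : M.ι} {f g : t ⟶ (M.X i).obj} :
    ((⟨i, f⟩ : El M t) = ⟨i, g⟩) ↔ f = g :=
  ⟨fun h => eq_of_heq (El.mk.inj h).2, fun h => by rw [h]⟩

open Classical in
/-- The matrix with a single (possibly) nonzero entry `a`. -/
noncomputable def place (i : M.ι) (j : N.ι) (a : M.X i ⟶ N.X j) : M ⟶ N :=
  (Pi.single i (Pi.single j a) : ∀ i j, M.X i ⟶ N.X j)

theorem place_same (i : M.ι) (j : N.ι) (a : M.X i ⟶ N.X j) : (place i j a : M ⟶ N) i j = a := by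
  classical
  have : (Pi.single i (Pi.single j a) : ∀ i j, M.X i ⟶ N.X j) i j = a := by simp
  convert! this

theorem place_ne (i : M.ι) (j : N.ι) (a : M.X i ⟶ N.X j) {i' : M.ι} {j' : N.ι}
    (h : i' ≠ i ∨ j' ≠ j) : (place i j a : M ⟶ N) i' j' = 0 := by
  classical
  have : (Pi.single i (Pi.single j a) : ∀ i j, M.X i ⟶ N.X j) i' j' = 0 := by
    by_cases hi : i' = i
    · subst hi
      rw [Pi.single_eq_same, Pi.single_eq_of_ne (h.resolve_left (by simp))]
    · rw [Pi.single_eq_of_ne hi, Pi.zero_apply]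
  convert! this

theorem place_ext {i : M.ι} {j : N.ι} {a : M.X i ⟶ N.X j} {F : M ⟶ N} (h : F i j = a)
    (h' : ∀ i' j', i' ≠ i ∨ j' ≠ j → F i' j' = 0) : place i j a = F := by
  funext i' j'
  by_cases hi : i' = i
  · subst hi
    by_cases hj : j' = j
    · subst hj
      rw [place_same, h]
    · rw [place_ne _ _ _ (Or.inr hj), h' _ _ (Or.inr hj)]
  · rw [place_ne _ _ _ (Or.inl hi), h' _ _ (Or.inl hi)]

theorem place_zero (i : M.ι) (j : N.ι) : place i j (0 : M.X i ⟶ N.X j) = 0 :=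
  place_ext rfl fun _ _ _ => rfl

theorem place_add (i : M.ι) (j : N.ι) (a b : M.X i ⟶ N.X j) :
    place i j (a + b) = place i j a + place i j b :=
  place_ext (by rw [Mat_.add_apply, place_same, place_same]) fun _ _ h => by
    rw [Mat_.add_apply, place_ne _ _ _ h, place_ne _ _ _ h, add_zero]

theorem mat_smul_apply (c : K) (F : M ⟶ N) (i : M.ι) (j : N.ι) : (c • F) i j = c • F i j := rfl

theorem mat_sum_apply {ι : Type*} (s : Finset ι) (F : ι → (M ⟶ N)) (i : M.ι) (j : N.ι) :
    (∑ k ∈ s, F k) i j = ∑ k ∈ s, F k i j :=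
  map_sum (⟨⟨fun F => F i j, rfl⟩, fun _ _ => rfl⟩ : (M ⟶ N) →+ (M.X i ⟶ N.X j)) F s

theorem place_smul (i : M.ι) (j : N.ι) (c : K) (a : M.X i ⟶ N.X j) :
    place i j (c • a) = c • place i j a :=
  place_ext (by rw [mat_smul_apply, place_same]) fun _ _ h => by
    rw [mat_smul_apply, place_ne _ _ _ h, smul_zero]

theorem place_comp (i : M.ι) (j : N.ι) (k : P.ι) (a : M.X i ⟶ N.X j) (b : N.X j ⟶ P.X k) :
    (place i j a : M ⟶ N) ≫ (place j k b : N ⟶ P) = place i k (a ≫ b) := by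
  funext i' k'
  rw [Mat_.comp_apply]
  rw [Finset.sum_eq_single j]
  · by_cases hi : i' = i
    · subst hi
      by_cases hk : k' = k
      · subst hk
        rw [place_same, place_same, place_same]
      · rw [place_ne j k b (Or.inr hk), place_ne _ k _ (Or.inr hk), comp_zero]
    · rw [place_ne i j a (Or.inl hi), place_ne i _ _ (Or.inl hi), zero_comp]
  · intro j' _ hj
    rw [place_ne i j a (Or.inr hj), zero_comp]
  · simp

theorem place_comp_ne (i : M.ι) {j j' : N.ι} (k : P.ι) (a : M.X i ⟶ N.X j) (b : N.X j' ⟶ P.X k)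
    (h : j ≠ j') : (place i j a : M ⟶ N) ≫ (place j' k b : N ⟶ P) = 0 := by
  funext i' k'
  rw [Mat_.comp_apply]
  refine Finset.sum_eq_zero fun l _ => ?_
  by_cases hl : l = j
  · subst hl
    rw [place_ne j' k b (Or.inl h), comp_zero]
  · rw [place_ne i j a (Or.inr hl), zero_comp]

/-- The morphism attached to a pair of points `a`, `b` of `M` and `N` with the same source. -/
noncomputable def msp (a : El M t) (b : El N t) : M ⟶ N :=
  place a.idx b.idx (sp δ a.mor b.mor : Rel _ _ →₀ K)

theorem msp_induction {p : (M ⟶ N) → Prop} (zero : p 0) (add : ∀ f g, p f → p g → p (f + g))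
    (smul : ∀ (c : K) (f), p f → p (c • f)) (h : ∀ (t : A) (a : El M t) (b : El N t), p (msp a b))
    (f : M ⟶ N) : p f := by
  classical
  have hp : ∀ i j (x : Rel (M.X i).obj (N.X j).obj →₀ K), p (place i j x) := by
    intro i j x
    induction x using Finsupp.induction_linear with
    | zero => exact (place_zero (M := M) (N := N) i j) ▸ zero
    | add x y hx hy => exact (place_add (M := M) (N := N) i j x y) ▸ add _ _ hx hy
    | single r c =>
      have h1 : (Finsupp.single r c : Rel (M.X i).obj (N.X j).obj →₀ K) =
          c • sp δ r.rep.fst r.rep.snd := by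
        rw [← single_eq_sp, Finsupp.smul_single, smul_eq_mul, mul_one]
      rw [h1]
      exact (place_smul (M := M) (N := N) i j c (sp δ r.rep.fst r.rep.snd)) ▸
        smul c _ (h _ ⟨i, r.rep.fst⟩ ⟨j, r.rep.snd⟩)
  have hs : ∀ {ι : Type} (s : Finset ι) (F : ι → (M ⟶ N)), (∀ i, p (F i)) → p (∑ i ∈ s, F i) :=
    fun s F hF => Finset.sum_induction F p add zero fun i _ => hF i
  have : f = ∑ i, ∑ j, place i j (f i j) := by
    funext i j
    rw [mat_sum_apply, Finset.sum_eq_single i, mat_sum_apply, Finset.sum_eq_single j, place_same]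
    · intro j' _ hj
      rw [place_ne _ _ _ (Or.inr hj.symm)]
    · simp
    · intro i' _ hi
      rw [mat_sum_apply]
      exact Finset.sum_eq_zero fun j' _ => place_ne _ _ _ (Or.inl hi.symm)
    · simp
  rw [this]
  exact hs _ _ fun i => hs _ _ fun j => hp i j _

/-- Pullbacks of points. -/
structure ElPB {w : A} (p : w ⟶ t) (q : w ⟶ t') (b : El N t) (c : El N t') : Prop where
  jm : JM p q
  comm : b.pre p = c.pre q
  exists_lift : ∀ ⦃s : A⦄ (f : s ⟶ t) (g : s ⟶ t'), b.pre f = c.pre g →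
    ∃ l : s ⟶ w, l ≫ p = f ∧ l ≫ q = g

theorem exists_elPB {s : A} {b : El N t} {c : El N t'} {f : s ⟶ t} {g : s ⟶ t'}
    (h : b.pre f = c.pre g) : ∃ (w : A) (p : w ⟶ t) (q : w ⟶ t'), ElPB p q b c := by
  obtain ⟨j, b⟩ := b
  obtain ⟨j', c⟩ := c
  obtain rfl : j = j' := (El.mk.inj h).1
  obtain ⟨w, p, q, hP⟩ := exists_isPullback (El.mk_eq.1 h)
  exact ⟨w, p, q, fun _ _ _ h1 h2 => hP.hom_ext h1 h2, El.mk_eq.2 hP.w, fun s f g h =>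
    ⟨hP.lift f g (El.mk_eq.1 h), hP.lift_fst _ _ _, hP.lift_snd _ _ _⟩⟩

theorem msp_comp {w : A} {p : w ⟶ t} {q : w ⟶ t'} (a : El M t) {b : El N t} {c : El N t'}
    (d : El P t') (h : ElPB p q b c) : msp a b ≫ msp c d = msp (a.pre p) (d.pre q) := by
  obtain ⟨j, b⟩ := b
  obtain ⟨j', c⟩ := c
  obtain rfl : j = j' := (El.mk.inj h.comm).1
  have hP : IsPullback p q b c := IsPullback.mk' (El.mk_eq.1 h.comm) (fun _ _ _ h1 h2 => h.jm _ _ h1 h2)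
    (fun s f g hfg => h.exists_lift f g (El.mk_eq.2 hfg))
  refine (place_comp _ _ _ _ _).trans ?_
  exact congrArg (place (M := M) (N := P) a.idx d.idx) (comp_sp δ hP)

theorem msp_comp_zero (a : El M t) {b : El N t} {c : El N t'} (d : El P t')
    (h : ∀ ⦃s : A⦄ (f : s ⟶ t) (g : s ⟶ t'), b.pre f ≠ c.pre g) : msp a b ≫ msp c d = 0 := by
  obtain ⟨j, b⟩ := b
  obtain ⟨j', c⟩ := c
  by_cases hj : j = j'
  · subst hj
    refine (place_comp _ _ _ _ _).trans ?_
    refine (congrArg (place (M := M) (N := P) a.idx d.idx) (comp_sp_zero δ ?_)).trans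
      (place_zero _ _)
    intro s f g hfg
    exact h f g (El.mk_eq.2 hfg)
  · exact place_comp_ne _ _ _ _ hj

/-- A natural family of maps on points. -/
structure ElHom (M N : Mat_ (T0 δ)) where
  app : ∀ {t : A}, El M t → El N t
  nat : ∀ {t t' : A} (a : El M t) (p : t' ⟶ t), app (a.pre p) = (app a).pre p

/-- The morphism of families given by a natural family of maps on points. -/
noncomputable def gr (φ : ElHom M N) : M ⟶ N :=
  ∑ i : M.ι, msp (⟨i, 𝟙 (M.X i).obj⟩ : El M _) (φ.app ⟨i, 𝟙 (M.X i).obj⟩)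

theorem msp_gr (a : El M t) (b : El N t) (φ : ElHom N P) : msp a b ≫ gr φ = msp a (φ.app b) := by
  obtain ⟨j, b⟩ := b
  rw [gr, Preadditive.comp_sum, Finset.sum_eq_single j]
  · have h : ElPB (𝟙 t) b (⟨j, b⟩ : El N t) ⟨j, 𝟙 (N.X j).obj⟩ :=
      ⟨jm_id_left _, El.mk_eq.2 (by simp), fun s f g h => ⟨f, by simp, by
        have := El.mk_eq.1 h
        simpa using this⟩⟩
    rw [msp_comp _ _ h, El.pre_id, ← φ.nat, El.mk_pre]
  · intro i _ hi
    exact msp_comp_zero _ _ fun s f g h => hi (El.mk.inj h).1.symm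
  · simp

theorem gr_msp (φ : ElHom M N) (ψ : ElHom N M) (h1 : ∀ t (a : El M t), ψ.app (φ.app a) = a)
    (h2 : ∀ t (a : El N t), φ.app (ψ.app a) = a) (c : El N t) (d : El P t) :
    gr φ ≫ msp c d = msp (ψ.app c) d := by
  have key : ∀ (i : M.ι) (s : A) (f : s ⟶ (M.X i).obj) (g : s ⟶ t),
      (φ.app ⟨i, 𝟙 (M.X i).obj⟩).pre f = c.pre g ↔ (⟨i, f⟩ : El M s) = (ψ.app c).pre g := by
    intro i s f g
    rw [← φ.nat, ← ψ.nat]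
    rw [El.mk_pre]
    exact ⟨fun h => by rw [← h, h1], fun h => by rw [h, h2]⟩
  generalize ψ.app c = b at key ⊢
  obtain ⟨j, b⟩ := b
  rw [gr, Preadditive.sum_comp, Finset.sum_eq_single j]
  · have h : ElPB b (𝟙 t) (φ.app ⟨j, 𝟙 (M.X j).obj⟩) c :=
      ⟨fun _ _ _ _ h => by simpa using h, (key _ _ _ _).2 (by simp [El.pre]), fun s f g h =>
        ⟨g, (El.mk_eq.1 ((key _ _ _ _).1 h)).symm, by simp⟩⟩
    rw [msp_comp _ _ h, El.pre_id, El.mk_pre]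
  · intro i _ hi
    exact msp_comp_zero _ _ fun s f g h => hi (El.mk.inj ((key _ _ _ _).1 h)).1
  · simp

theorem comp_gr_id {φ : ElHom N N} (hφ : ∀ t (a : El N t), φ.app a = a) (f : M ⟶ N) :
    f ≫ gr φ = f := by
  induction f using msp_induction with
  | zero => simp
  | add f g hf hg => rw [Preadditive.add_comp, hf, hg]
  | smul c f hf => rw [Linear.smul_comp, hf]
  | h t a b => rw [msp_gr, hφ]

theorem gr_id {φ : ElHom N N} (hφ : ∀ t (a : El N t), φ.app a = a) : gr φ = 𝟙 N := by
  rw [← comp_gr_id hφ (𝟙 N), Category.id_comp]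

/-- The identity family of maps on points. -/
def ElHom.id (M : Mat_ (T0 δ)) : ElHom M M := ⟨fun a => a, fun _ _ => rfl⟩

/-- Composition of families of maps on points. -/
def ElHom.comp (φ : ElHom M N) (ψ : ElHom N P) : ElHom M P :=
  ⟨fun a => ψ.app (φ.app a), fun a p => by rw [φ.nat, ψ.nat]⟩

theorem gr_ElHom_id (M : Mat_ (T0 δ)) : gr (ElHom.id M) = 𝟙 M := gr_id fun _ _ => rfl

theorem gr_comp (φ : ElHom M N) (ψ : ElHom N P) : gr φ ≫ gr ψ = gr (φ.comp ψ) := by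
  rw [gr, Preadditive.sum_comp, gr]
  exact Finset.sum_congr rfl fun i _ => msp_gr _ _ _

theorem gr_congr {φ ψ : ElHom M N} (h : ∀ t (a : El M t), φ.app a = ψ.app a) : gr φ = gr ψ := by
  rw [gr, gr]
  exact Finset.sum_congr rfl fun i _ => by rw [h]

/-- A natural bijection on points. -/
structure ElIso (M N : Mat_ (T0 δ)) where
  hom : ElHom M N
  inv : ElHom N M
  hom_inv : ∀ t (a : El M t), inv.app (hom.app a) = a
  inv_hom : ∀ t (a : El N t), hom.app (inv.app a) = a

/-- The isomorphism of families given by a natural bijection on points. -/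
noncomputable def ElIso.iso (e : ElIso M N) : M ≅ N where
  hom := gr e.hom
  inv := gr e.inv
  hom_inv_id := by rw [gr_comp]; exact gr_id e.hom_inv
  inv_hom_id := by rw [gr_comp]; exact gr_id e.inv_hom

theorem iso_hom_msp (e : ElIso M N) (c : El N t) (d : El P t) :
    e.iso.hom ≫ msp c d = msp (e.inv.app c) d := gr_msp e.hom e.inv e.hom_inv e.inv_hom c d

theorem msp_iso_hom (e : ElIso M N) (c : El P t) (d : El M t) :
    msp c d ≫ e.iso.hom = msp c (e.hom.app d) := msp_gr _ _ _

end MatTensor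

end Knop

namespace Knop

universe w v u

section MatMonoidal

variable {K : Type w} [Field K] {A : Type u} [Category.{v} A] [RegularCategory A]
  {δ : DegreeFunction K A} {M N P Q M' N' P' Q' : Mat_ (T0 δ)} {t t' t'' : A}

/-- The tensor product of two finite families `([xᵢ])ᵢ`, `([yⱼ])ⱼ`: the family of all `[xᵢ × yⱼ]` for
which the product exists (`[xᵢ] ⊗ [yⱼ]` is zero when it does not). -/
noncomputable def tensorObj (M N : Mat_ (T0 δ)) : Mat_ (T0 δ) :=
  letI : Fintype {p : M.ι × N.ι // HasBinaryProduct (M.X p.1).obj (N.X p.2).obj} :=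
    Fintype.ofFinite _
  { ι := {p : M.ι × N.ι // HasBinaryProduct (M.X p.1).obj (N.X p.2).obj}
    X := fun p => haveI := p.2; T0.of ((M.X p.1.1).obj ⨯ (N.X p.1.2).obj) }

/-- The tensor product of two matrices of morphisms: the matrix of tensor products of entries. -/
noncomputable def tensorHom (f : M ⟶ N) (g : P ⟶ Q) : tensorObj M P ⟶ tensorObj N Q :=
  fun p q =>
    haveI := p.2
    haveI := q.2
    tens δ (M.X p.1.1).obj (N.X q.1.1).obj (P.X p.1.2).obj (Q.X q.1.2).obj
      (f p.1.1 q.1.1) (g p.1.2 q.1.2)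

theorem tensorHom_apply (f : M ⟶ N) (g : P ⟶ Q) (i : M.ι) (k : P.ι) (j : N.ι) (l : Q.ι)
    (h : HasBinaryProduct (M.X i).obj (P.X k).obj) (h' : HasBinaryProduct (N.X j).obj (Q.X l).obj) :
    tensorHom f g ⟨(i, k), h⟩ ⟨(j, l), h'⟩ = tens δ (M.X i).obj (N.X j).obj (P.X k).obj (Q.X l).obj
      (f i j) (g k l) := rfl

theorem tensorHom_add (f : M ⟶ N) (g h : P ⟶ Q) :
    tensorHom f (g + h) = tensorHom f g + tensorHom f h := by
  funext ⟨⟨i, k⟩, hi⟩ ⟨⟨j, l⟩, hj⟩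
  exact map_add (tens δ (M.X i).obj (N.X j).obj (P.X k).obj (Q.X l).obj (f i j)) (g k l) (h k l)

theorem add_tensorHom (f g : M ⟶ N) (h : P ⟶ Q) :
    tensorHom (f + g) h = tensorHom f h + tensorHom g h := by
  funext ⟨⟨i, k⟩, hi⟩ ⟨⟨j, l⟩, hj⟩
  exact LinearMap.map_add₂ (tens δ (M.X i).obj (N.X j).obj (P.X k).obj (Q.X l).obj)
    (f i j) (g i j) (h k l)

theorem tensorHom_smul (c : K) (f : M ⟶ N) (g : P ⟶ Q) :
    tensorHom f (c • g) = c • tensorHom f g := by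
  funext ⟨⟨i, k⟩, hi⟩ ⟨⟨j, l⟩, hj⟩
  exact map_smul (tens δ (M.X i).obj (N.X j).obj (P.X k).obj (Q.X l).obj (f i j)) c (g k l)

theorem smul_tensorHom (c : K) (f : M ⟶ N) (g : P ⟶ Q) :
    tensorHom (c • f) g = c • tensorHom f g := by
  funext ⟨⟨i, k⟩, hi⟩ ⟨⟨j, l⟩, hj⟩
  exact LinearMap.map_smul₂ (tens δ (M.X i).obj (N.X j).obj (P.X k).obj (Q.X l).obj) c
    (f i j) (g k l)

theorem tensorHom_zero (f : M ⟶ N) : tensorHom f (0 : P ⟶ Q) = 0 := by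
  simpa using tensorHom_smul (0 : K) f (0 : P ⟶ Q)

theorem zero_tensorHom (g : P ⟶ Q) : tensorHom (0 : M ⟶ N) g = 0 := by
  simpa using smul_tensorHom (0 : K) (0 : M ⟶ N) g

theorem sum_tensorHom {ι : Type*} (s : Finset ι) (f : ι → (M ⟶ N)) (g : P ⟶ Q) :
    tensorHom (∑ i ∈ s, f i) g = ∑ i ∈ s, tensorHom (f i) g :=
  map_sum (⟨⟨fun f => tensorHom f g, zero_tensorHom g⟩, fun _ _ => add_tensorHom _ _ _⟩ :
    (M ⟶ N) →+ _) f s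

theorem tensorHom_sum {ι : Type*} (s : Finset ι) (f : M ⟶ N) (g : ι → (P ⟶ Q)) :
    tensorHom f (∑ i ∈ s, g i) = ∑ i ∈ s, tensorHom f (g i) :=
  map_sum (⟨⟨fun g => tensorHom f g, tensorHom_zero f⟩, fun _ _ => tensorHom_add _ _ _⟩ :
    (P ⟶ Q) →+ _) g s

/-- The point of `M ⊗ N` given by a point of `M` and a point of `N`. -/
noncomputable def El.pair (a : El M t) (b : El N t) : El (tensorObj M N) t :=
  haveI := hasProd a.mor b.mor
  ⟨⟨(a.idx, b.idx), hasProd a.mor b.mor⟩, prod.lift a.mor b.mor⟩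

/-- First projection on points. -/
noncomputable def El.p1 (a : El (tensorObj M N) t) : El M t :=
  haveI := a.idx.2
  ⟨a.idx.1.1, a.mor ≫ prod.fst⟩

/-- Second projection on points. -/
noncomputable def El.p2 (a : El (tensorObj M N) t) : El N t :=
  haveI := a.idx.2
  ⟨a.idx.1.2, a.mor ≫ prod.snd⟩

theorem El.p1_pair (a : El M t) (b : El N t) : (a.pair b).p1 = a := by
  have := hasProd a.mor b.mor
  exact El.mk_eq.2 (plift_fst a.mor b.mor)

theorem El.p2_pair (a : El M t) (b : El N t) : (a.pair b).p2 = b := by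
  have := hasProd a.mor b.mor
  exact El.mk_eq.2 (plift_snd a.mor b.mor)

theorem El.pair_eta (a : El (tensorObj M N) t) : a.p1.pair a.p2 = a := by
  obtain ⟨⟨⟨i, k⟩, h⟩, f⟩ := a
  exact El.mk_eq.2 (plift_eta (x := (M.X i).obj) (y := (N.X k).obj) f)

theorem El.p1_pre (a : El (tensorObj M N) t) (p : t' ⟶ t) : (a.pre p).p1 = a.p1.pre p :=
  El.mk_eq.2 (Category.assoc _ _ _)

theorem El.p2_pre (a : El (tensorObj M N) t) (p : t' ⟶ t) : (a.pre p).p2 = a.p2.pre p :=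
  El.mk_eq.2 (Category.assoc _ _ _)

theorem El.prod_ext {a b : El (tensorObj M N) t} (h1 : a.p1 = b.p1) (h2 : a.p2 = b.p2) : a = b := by
  rw [← El.pair_eta a, ← El.pair_eta b, h1, h2]

theorem El.pair_pre (a : El M t) (b : El N t) (p : t' ⟶ t) :
    (a.pair b).pre p = (a.pre p).pair (b.pre p) :=
  El.prod_ext (by rw [El.p1_pre, El.p1_pair, El.p1_pair])
    (by rw [El.p2_pre, El.p2_pair, El.p2_pair])

theorem El.pair_inj {a a' : El M t} {b b' : El N t} :
    a.pair b = a'.pair b' ↔ a = a' ∧ b = b' :=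
  ⟨fun h => ⟨by rw [← El.p1_pair a b, h, El.p1_pair], by rw [← El.p2_pair a b, h, El.p2_pair]⟩,
    fun h => by rw [h.1, h.2]⟩

theorem tens_sp_zero {x y x' y' w w' : A} [HasBinaryProduct x x'] [HasBinaryProduct y y']
    {f : w ⟶ x} {g : w ⟶ y} {f' : w' ⟶ x'} {g' : w' ⟶ y'}
    (h : ∀ ⦃P : A⦄ (_ : P ⟶ w) (_ : P ⟶ w'), False) :
    tens δ x y x' y' (sp δ f g) (sp δ f' g') = 0 := (goodTens δ f g f' g').2 h

theorem place_tensor (i : M.ι) (j : N.ι) (k : P.ι) (l : Q.ι) (a : M.X i ⟶ N.X j)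
    (b : P.X k ⟶ Q.X l) (h : HasBinaryProduct (M.X i).obj (P.X k).obj)
    (h' : HasBinaryProduct (N.X j).obj (Q.X l).obj) :
    tensorHom (place i j a : M ⟶ N) (place k l b : P ⟶ Q) =
      place (M := tensorObj M P) (N := tensorObj N Q) ⟨(i, k), h⟩ ⟨(j, l), h'⟩
        (tens δ (M.X i).obj (N.X j).obj (P.X k).obj (Q.X l).obj a b) := by
  refine (place_ext ?_ ?_).symm
  · rw [tensorHom_apply, place_same, place_same]
  · rintro ⟨⟨i', k'⟩, h1⟩ ⟨⟨j', l'⟩, h2⟩ H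
    rw [tensorHom_apply]
    by_cases hij : i' ≠ i ∨ j' ≠ j
    · rw [place_ne _ _ _ hij]
      exact LinearMap.map_zero₂ (tens δ (M.X i').obj (N.X j').obj (P.X k').obj (Q.X l').obj) _
    · rw [place_ne k l]
      · exact map_zero (tens δ (M.X i').obj (N.X j').obj (P.X k').obj (Q.X l').obj _)
      · by_contra hkl
        push Not at hij hkl
        obtain ⟨rfl, rfl⟩ := hij
        obtain ⟨rfl, rfl⟩ := hkl
        exact H.elim (fun h => h rfl) (fun h => h rfl)

theorem msp_tensor {w : A} {p : w ⟶ t} {q : w ⟶ t'} (a : El M t) (b : El N t) (c : El P t')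
    (d : El Q t') (h : IsProd p q) : tensorHom (msp a b) (msp c d) =
      msp ((a.pre p).pair (c.pre q)) ((b.pre p).pair (d.pre q)) := by
  have h1 := hasProd (p ≫ a.mor) (q ≫ c.mor)
  have h2 := hasProd (p ≫ b.mor) (q ≫ d.mor)
  refine (place_tensor _ _ _ _ _ _ h1 h2).trans ?_
  exact congrArg (place (M := tensorObj M P) (N := tensorObj N Q) ⟨(a.idx, c.idx), h1⟩
    ⟨(b.idx, d.idx), h2⟩) ((goodTens δ a.mor b.mor c.mor d.mor).1 p q h)

theorem msp_tensor_zero (a : El M t) (b : El N t) (c : El P t') (d : El Q t')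
    (h : ∀ ⦃s : A⦄ (_ : s ⟶ t) (_ : s ⟶ t'), False) : tensorHom (msp a b) (msp c d) = 0 := by
  funext ⟨⟨i, k⟩, hi⟩ ⟨⟨j, l⟩, hj⟩
  rw [tensorHom_apply]
  by_cases hij : i ≠ a.idx ∨ j ≠ b.idx
  · rw [msp, place_ne _ _ _ hij]
    exact LinearMap.map_zero₂ (tens δ (M.X i).obj (N.X j).obj (P.X k).obj (Q.X l).obj) _
  · by_cases hkl : k ≠ c.idx ∨ l ≠ d.idx
    · rw [msp, msp, place_ne c.idx _ _ hkl]
      exact map_zero (tens δ (M.X i).obj (N.X j).obj (P.X k).obj (Q.X l).obj _)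
    · push Not at hij hkl
      obtain ⟨rfl, rfl⟩ := hij
      obtain ⟨rfl, rfl⟩ := hkl
      rw [msp, msp, place_same, place_same]
      exact tens_sp_zero h

/-- The product of two families of maps on points. -/
noncomputable def ElHom.prod (φ : ElHom M N) (ψ : ElHom P Q) :
    ElHom (tensorObj M P) (tensorObj N Q) where
  app a := (φ.app a.p1).pair (ψ.app a.p2)
  nat a p := by rw [El.p1_pre, El.p2_pre, φ.nat, ψ.nat, El.pair_pre]

theorem gr_tensor (φ : ElHom M N) (ψ : ElHom P Q) :
    tensorHom (gr φ) (gr ψ) = gr (φ.prod ψ) := by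
  have key : ∀ (i : M.ι) (k : P.ι) (h : HasBinaryProduct (M.X i).obj (P.X k).obj),
      ∀ x : El (tensorObj M P) ((M.X i).obj ⨯ (P.X k).obj),
      x = ⟨⟨(i, k), h⟩, 𝟙 ((M.X i).obj ⨯ (P.X k).obj)⟩ →
      msp x ((φ.prod ψ).app x) =
      tensorHom (msp (⟨i, 𝟙 _⟩ : El M _) (φ.app ⟨i, 𝟙 _⟩))
        (msp (⟨k, 𝟙 _⟩ : El P _) (ψ.app ⟨k, 𝟙 _⟩)) := by
    intro i k h x hx
    rw [msp_tensor _ _ _ _ (isProd_prod (M.X i).obj (P.X k).obj), ← φ.nat, ← ψ.nat]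
    have e : (El.pre (⟨i, 𝟙 _⟩ : El M _) (prod.fst : (M.X i).obj ⨯ (P.X k).obj ⟶ _)).pair
        (El.pre (⟨k, 𝟙 _⟩ : El P _) (prod.snd : (M.X i).obj ⨯ (P.X k).obj ⟶ _)) = x := by
      rw [hx]
      refine El.prod_ext ?_ ?_
      · rw [El.p1_pair, El.mk_pre]
        exact El.mk_eq.2 (Category.id_comp _).symm
      · rw [El.p2_pair, El.mk_pre]
        exact El.mk_eq.2 (Category.id_comp _).symm
    rw [← e]
    simp only [ElHom.prod, El.p1_pair, El.p2_pair]
  rw [gr, gr, sum_tensorHom]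
  simp only [tensorHom_sum]
  rw [← Fintype.sum_prod_type' (f := fun i k => tensorHom (msp (⟨i, 𝟙 _⟩ : El M _) (φ.app ⟨i, 𝟙 _⟩))
        (msp (⟨k, 𝟙 _⟩ : El P _) (ψ.app ⟨k, 𝟙 _⟩))), gr]
  symm
  refine Fintype.sum_of_injective (fun p : (tensorObj M P).ι => p.1)
    (fun p q h => Subtype.ext h) _ _ ?_ ?_
  · rintro ⟨i, k⟩ h
    refine msp_tensor_zero _ _ _ _ fun s f g => h ⟨⟨(i, k), hasProd f g⟩, rfl⟩
  · rintro ⟨⟨i, k⟩, h⟩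
    exact key i k h _ rfl

theorem tensor_comp_msp {t₁ t₂ t₃ t₄ : A} (a₁ : El M t₁) (b₁ : El N t₁) (a₂ : El M' t₂)
    (b₂ : El N' t₂) (a₃ : El N t₃) (b₃ : El P t₃) (a₄ : El N' t₄) (b₄ : El P' t₄) :
    tensorHom (msp a₁ b₁) (msp a₂ b₂) ≫ tensorHom (msp a₃ b₃) (msp a₄ b₄) =
      tensorHom (msp a₁ b₁ ≫ msp a₃ b₃) (msp a₂ b₂ ≫ msp a₄ b₄) := by
  by_cases H : ∃ (s : A) (f₁ : s ⟶ t₁) (f₂ : s ⟶ t₂) (f₃ : s ⟶ t₃) (f₄ : s ⟶ t₄),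
      b₁.pre f₁ = a₃.pre f₃ ∧ b₂.pre f₂ = a₄.pre f₄
  · obtain ⟨s, f₁, f₂, f₃, f₄, h1, h2⟩ := H
    obtain ⟨W, p₁, p₂, hW⟩ := exists_isProd f₁ f₂
    obtain ⟨W', p₃, p₄, hW'⟩ := exists_isProd f₃ f₄
    obtain ⟨R, r₁, r₃, hR⟩ := exists_elPB h1
    obtain ⟨R', r₂, r₄, hR'⟩ := exists_elPB h2
    obtain ⟨m, hm1, hm3⟩ := hR.exists_lift f₁ f₃ h1
    obtain ⟨m', hm2, hm4⟩ := hR'.exists_lift f₂ f₄ h2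
    obtain ⟨S, s₁, s₂, hS⟩ := exists_isProd m m'
    obtain ⟨u, hu1, hu2⟩ := hW.exists_lift (s₁ ≫ r₁) (s₂ ≫ r₂)
    obtain ⟨u', hu3, hu4⟩ := hW'.exists_lift (s₁ ≫ r₃) (s₂ ≫ r₄)
    have hPB : ElPB u u' ((b₁.pre p₁).pair (b₂.pre p₂)) ((a₃.pre p₃).pair (a₄.pre p₄)) := by
      refine ⟨fun T x y hx hy => ?_, ?_, fun T x y hxy => ?_⟩
      · refine hS.jm _ _ (hR.jm _ _ ?_ ?_) (hR'.jm _ _ ?_ ?_)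
        · rw [Category.assoc, Category.assoc, ← hu1, reassoc_of% hx]
        · rw [Category.assoc, Category.assoc, ← hu3, reassoc_of% hy]
        · rw [Category.assoc, Category.assoc, ← hu2, reassoc_of% hx]
        · rw [Category.assoc, Category.assoc, ← hu4, reassoc_of% hy]
      · rw [El.pair_pre, El.pair_pre, El.pre_pre, El.pre_pre, El.pre_pre, El.pre_pre, hu1, hu2, hu3,
          hu4, ← El.pre_pre, ← El.pre_pre, ← El.pre_pre, ← El.pre_pre, hR.comm, hR'.comm]
      · rw [El.pair_pre, El.pair_pre, El.pre_pre, El.pre_pre, El.pre_pre, El.pre_pre,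
          El.pair_inj] at hxy
        obtain ⟨l, hl1, hl3⟩ := hR.exists_lift _ _ hxy.1
        obtain ⟨l', hl2, hl4⟩ := hR'.exists_lift _ _ hxy.2
        obtain ⟨n, hn1, hn2⟩ := hS.exists_lift l l'
        refine ⟨n, hW.jm _ _ ?_ ?_, hW'.jm _ _ ?_ ?_⟩
        · rw [Category.assoc, hu1, reassoc_of% hn1, hl1]
        · rw [Category.assoc, hu2, reassoc_of% hn2, hl2]
        · rw [Category.assoc, hu3, reassoc_of% hn1, hl3]
        · rw [Category.assoc, hu4, reassoc_of% hn2, hl4]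
    rw [msp_tensor _ _ _ _ hW, msp_tensor _ _ _ _ hW', msp_comp _ _ hPB, msp_comp _ _ hR,
      msp_comp _ _ hR', msp_tensor _ _ _ _ hS]
    simp only [El.pair_pre, El.pre_pre, hu1, hu2, hu3, hu4]
  · have hl : tensorHom (msp a₁ b₁) (msp a₂ b₂) ≫ tensorHom (msp a₃ b₃) (msp a₄ b₄) = 0 := by
      by_cases h1 : ∃ (s : A) (_ : s ⟶ t₁) (_ : s ⟶ t₂), True
      · by_cases h2 : ∃ (s : A) (_ : s ⟶ t₃) (_ : s ⟶ t₄), True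
        · obtain ⟨s, f₁, f₂, -⟩ := h1
          obtain ⟨s', f₃, f₄, -⟩ := h2
          obtain ⟨W, p₁, p₂, hW⟩ := exists_isProd f₁ f₂
          obtain ⟨W', p₃, p₄, hW'⟩ := exists_isProd f₃ f₄
          rw [msp_tensor _ _ _ _ hW, msp_tensor _ _ _ _ hW', msp_comp_zero]
          intro T x y hxy
          rw [El.pair_pre, El.pair_pre, El.pre_pre, El.pre_pre, El.pre_pre, El.pre_pre,
            El.pair_inj] at hxy
          exact H ⟨T, _, _, _, _, hxy.1, hxy.2⟩
        · rw [msp_tensor_zero a₃ b₃ a₄ b₄, comp_zero]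
          exact fun s f g => h2 ⟨s, f, g, trivial⟩
      · rw [msp_tensor_zero a₁ b₁ a₂ b₂, zero_comp]
        exact fun s f g => h1 ⟨s, f, g, trivial⟩
    have hr : tensorHom (msp a₁ b₁ ≫ msp a₃ b₃) (msp a₂ b₂ ≫ msp a₄ b₄) = 0 := by
      by_cases h1 : ∃ (s : A) (f : s ⟶ t₁) (g : s ⟶ t₃), b₁.pre f = a₃.pre g
      · by_cases h2 : ∃ (s : A) (f : s ⟶ t₂) (g : s ⟶ t₄), b₂.pre f = a₄.pre g
        · obtain ⟨s, f₁, f₃, h1⟩ := h1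
          obtain ⟨s', f₂, f₄, h2⟩ := h2
          obtain ⟨R, r₁, r₃, hR⟩ := exists_elPB h1
          obtain ⟨R', r₂, r₄, hR'⟩ := exists_elPB h2
          rw [msp_comp _ _ hR, msp_comp _ _ hR', msp_tensor_zero]
          intro T x y
          exact H ⟨T, x ≫ r₁, y ≫ r₂, x ≫ r₃, y ≫ r₄, by
            rw [← El.pre_pre, ← El.pre_pre, hR.comm], by
            rw [← El.pre_pre, ← El.pre_pre, hR'.comm]⟩
        · rw [msp_comp_zero a₂ b₄ fun s f g h => h2 ⟨s, f, g, h⟩, tensorHom_zero]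
      · rw [msp_comp_zero a₁ b₃ fun s f g h => h1 ⟨s, f, g, h⟩, zero_tensorHom]
    rw [hl, hr]

theorem tensor_comp (f₁ : M ⟶ N) (f₂ : M' ⟶ N') (g₁ : N ⟶ P) (g₂ : N' ⟶ P') :
    tensorHom f₁ f₂ ≫ tensorHom g₁ g₂ = tensorHom (f₁ ≫ g₁) (f₂ ≫ g₂) := by
  induction f₁ using msp_induction with
  | zero => simp only [zero_tensorHom, zero_comp]
  | add x y hx hy => simp only [add_tensorHom, Preadditive.add_comp, hx, hy]
  | smul c x hx => simp only [smul_tensorHom, Linear.smul_comp, hx]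
  | h t₁ a₁ b₁ =>
  induction f₂ using msp_induction with
  | zero => simp only [tensorHom_zero, zero_comp]
  | add x y hx hy => simp only [tensorHom_add, Preadditive.add_comp, hx, hy]
  | smul c x hx => simp only [tensorHom_smul, Linear.smul_comp, hx]
  | h t₂ a₂ b₂ =>
  induction g₁ using msp_induction with
  | zero => simp only [zero_tensorHom, comp_zero]
  | add x y hx hy => simp only [add_tensorHom, Preadditive.comp_add, hx, hy]
  | smul c x hx => simp only [smul_tensorHom, Linear.comp_smul, hx]
  | h t₃ a₃ b₃ =>
  induction g₂ using msp_induction with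
  | zero => simp only [tensorHom_zero, comp_zero]
  | add x y hx hy => simp only [tensorHom_add, Preadditive.comp_add, hx, hy]
  | smul c x hx => simp only [tensorHom_smul, Linear.comp_smul, hx]
  | h t₄ a₄ b₄ => exact tensor_comp_msp _ _ _ _ _ _ _ _

end MatMonoidal

end Knop

namespace Knop

universe w v u

section MatMonoidalCategory

variable {K : Type w} [Field K] {A : Type u} [Category.{v} A] [RegularCategory A]
  {δ : DegreeFunction K A}

/-- The unit: the one-element family consisting of the terminal object. -/
noncomputable def tensorUnit (δ : DegreeFunction K A) : Mat_ (T0 δ) where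
  ι := PUnit
  X _ := T0.of (⊤_ A)

/-- The unique `t`-point of the unit. -/
noncomputable def El.unit (t : A) : El (tensorUnit δ) t := ⟨PUnit.unit, terminal.from t⟩

theorem El.eq_unit {t : A} (a : El (tensorUnit δ) t) : a = El.unit t := by
  obtain ⟨⟨⟩, f⟩ := a
  exact El.mk_eq.2 (Subsingleton.elim (α := t ⟶ ⊤_ A) _ _)

/-- On points, the associator is `((a, b), c) ↦ (a, (b, c))`. -/
noncomputable def assocEl (M N P : Mat_ (T0 δ)) :
    ElIso (tensorObj (tensorObj M N) P) (tensorObj M (tensorObj N P)) where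
  hom := ⟨fun a => a.p1.p1.pair (a.p1.p2.pair a.p2), fun a p => by
    simp only [El.p1_pre, El.p2_pre, El.pair_pre]⟩
  inv := ⟨fun a => (a.p1.pair a.p2.p1).pair a.p2.p2, fun a p => by
    simp only [El.p1_pre, El.p2_pre, El.pair_pre]⟩
  hom_inv t a := by simp only [El.p1_pair, El.p2_pair, El.pair_eta]
  inv_hom t a := by simp only [El.p1_pair, El.p2_pair, El.pair_eta]

/-- On points, the left unitor is `(⋆, a) ↦ a`. -/
noncomputable def leftUnitEl (M : Mat_ (T0 δ)) : ElIso (tensorObj (tensorUnit δ) M) M where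
  hom := ⟨fun a => a.p2, fun a p => El.p2_pre a p⟩
  inv := ⟨fun {t} a => (El.unit t).pair a, fun a p => by
    rw [El.pair_pre, El.eq_unit ((El.unit _).pre p)]⟩
  hom_inv t a := by
    change (El.unit t).pair a.p2 = a
    rw [← El.eq_unit a.p1, El.pair_eta]
  inv_hom t a := El.p2_pair _ _

/-- On points, the right unitor is `(a, ⋆) ↦ a`. -/
noncomputable def rightUnitEl (M : Mat_ (T0 δ)) : ElIso (tensorObj M (tensorUnit δ)) M where
  hom := ⟨fun a => a.p1, fun a p => El.p1_pre a p⟩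
  inv := ⟨fun {t} a => a.pair (El.unit t), fun a p => by
    rw [El.pair_pre, El.eq_unit ((El.unit _).pre p)]⟩
  hom_inv t a := by
    change a.p1.pair (El.unit t) = a
    rw [← El.eq_unit a.p2, El.pair_eta]
  inv_hom t a := El.p1_pair _ _

/-- On points, the braiding is `(a, b) ↦ (b, a)`. -/
noncomputable def braidEl (M N : Mat_ (T0 δ)) : ElIso (tensorObj M N) (tensorObj N M) where
  hom := ⟨fun a => a.p2.pair a.p1, fun a p => by simp only [El.p1_pre, El.p2_pre, El.pair_pre]⟩
  inv := ⟨fun a => a.p2.pair a.p1, fun a p => by simp only [El.p1_pre, El.p2_pre, El.pair_pre]⟩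
  hom_inv t a := by simp only [El.p1_pair, El.p2_pair, El.pair_eta]
  inv_hom t a := by simp only [El.p1_pair, El.p2_pair, El.pair_eta]

variable {M N P Q M' N' P' Q' : Mat_ (T0 δ)} {t t' t'' : A}

theorem assoc_nat_msp (a : El M t) (b : El M' t) (c : El N t') (d : El N' t') (e : El P t'')
    (f : El P' t'') :
    tensorHom (tensorHom (msp a b) (msp c d)) (msp e f) ≫ (assocEl M' N' P').iso.hom =
      (assocEl M N P).iso.hom ≫ tensorHom (msp a b) (tensorHom (msp c d) (msp e f)) := by
  by_cases H : ∃ (s : A) (_ : s ⟶ t) (_ : s ⟶ t') (_ : s ⟶ t''), True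
  · obtain ⟨s, f₁, f₂, f₃, -⟩ := H
    obtain ⟨W, p₁, p₂, hW⟩ := exists_isProd f₁ f₂
    obtain ⟨g, hg1, hg2⟩ := hW.exists_lift f₁ f₂
    obtain ⟨S, s₁, s₂, hS⟩ := exists_isProd g f₃
    obtain ⟨V, q₂, q₃, hV⟩ := exists_isProd f₂ f₃
    obtain ⟨l, hl2, hl3⟩ := hV.exists_lift (s₁ ≫ p₂) s₂
    have hS' : IsProd (s₁ ≫ p₁) l := by
      refine ⟨fun T x y h1 h2 => hS.jm _ _ (hW.jm _ _ ?_ ?_) ?_, fun T x y => ?_⟩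
      · simpa using h1
      · rw [Category.assoc, Category.assoc, ← hl2, reassoc_of% h2]
      · rw [← hl3, reassoc_of% h2]
      · obtain ⟨m, hm1, hm2⟩ := hW.exists_lift x (y ≫ q₂)
        obtain ⟨n, hn1, hn2⟩ := hS.exists_lift m (y ≫ q₃)
        refine ⟨n, by rw [reassoc_of% hn1, hm1], hV.jm _ _ ?_ ?_⟩
        · rw [Category.assoc, hl2, reassoc_of% hn1, hm2]
        · rw [Category.assoc, hl3, hn2]
    rw [msp_tensor _ _ _ _ hW, msp_tensor _ _ _ _ hS, msp_tensor _ _ _ _ hV,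
      msp_tensor _ _ _ _ hS', msp_iso_hom, iso_hom_msp]
    simp only [assocEl, El.pair_pre, El.p1_pair, El.p2_pair, El.pre_pre, hl2, hl3]
  · have hl : tensorHom (tensorHom (msp a b) (msp c d)) (msp e f) = 0 := by
      by_cases h : ∃ (s : A) (_ : s ⟶ t) (_ : s ⟶ t'), True
      · obtain ⟨s, f₁, f₂, -⟩ := h
        obtain ⟨W, p₁, p₂, hW⟩ := exists_isProd f₁ f₂
        rw [msp_tensor _ _ _ _ hW, msp_tensor_zero]
        exact fun s f g => H ⟨s, f ≫ p₁, f ≫ p₂, g, trivial⟩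
      · rw [msp_tensor_zero a b c d fun s f g => h ⟨s, f, g, trivial⟩, zero_tensorHom]
    have hr : tensorHom (msp a b) (tensorHom (msp c d) (msp e f)) = 0 := by
      by_cases h : ∃ (s : A) (_ : s ⟶ t') (_ : s ⟶ t''), True
      · obtain ⟨s, f₁, f₂, -⟩ := h
        obtain ⟨W, p₁, p₂, hW⟩ := exists_isProd f₁ f₂
        rw [msp_tensor _ _ _ _ hW, msp_tensor_zero]
        exact fun s f g => H ⟨s, f, g ≫ p₁, g ≫ p₂, trivial⟩
      · rw [msp_tensor_zero c d e f fun s f g => h ⟨s, f, g, trivial⟩, tensorHom_zero]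
    rw [hl, hr, zero_comp, comp_zero]

theorem assoc_nat (f : M ⟶ M') (g : N ⟶ N') (h : P ⟶ P') :
    tensorHom (tensorHom f g) h ≫ (assocEl M' N' P').iso.hom =
      (assocEl M N P).iso.hom ≫ tensorHom f (tensorHom g h) := by
  induction f using msp_induction with
  | zero => simp only [zero_tensorHom, zero_comp, comp_zero]
  | add x y hx hy => simp only [add_tensorHom, Preadditive.add_comp, Preadditive.comp_add, hx, hy]
  | smul c x hx => simp only [smul_tensorHom, Linear.smul_comp, Linear.comp_smul, hx]
  | h t₁ a₁ b₁ =>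
  induction g using msp_induction with
  | zero => simp only [zero_tensorHom, tensorHom_zero, zero_comp, comp_zero]
  | add x y hx hy =>
    simp only [add_tensorHom, tensorHom_add, Preadditive.add_comp, Preadditive.comp_add, hx, hy]
  | smul c x hx =>
    simp only [smul_tensorHom, tensorHom_smul, Linear.smul_comp, Linear.comp_smul, hx]
  | h t₂ a₂ b₂ =>
  induction h using msp_induction with
  | zero => simp only [tensorHom_zero, zero_comp, comp_zero]
  | add x y hx hy => simp only [tensorHom_add, Preadditive.add_comp, Preadditive.comp_add, hx, hy]
  | smul c x hx => simp only [tensorHom_smul, Linear.smul_comp, Linear.comp_smul, hx]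
  | h t₃ a₃ b₃ => exact assoc_nat_msp _ _ _ _ _ _

theorem id_unit : 𝟙 (tensorUnit δ) = msp (El.unit (⊤_ A)) (El.unit (⊤_ A)) := by
  have : Unique (tensorUnit δ).ι := inferInstanceAs (Unique PUnit)
  rw [← gr_ElHom_id, gr, Fintype.sum_unique]
  rw [El.eq_unit ((ElHom.id _).app _)]
  exact congrArg (fun x => msp x (El.unit (⊤_ A))) (El.eq_unit _)

theorem leftUnit_nat (f : M ⟶ N) : tensorHom (𝟙 (tensorUnit δ)) f ≫ (leftUnitEl N).iso.hom =
    (leftUnitEl M).iso.hom ≫ f := by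
  induction f using msp_induction with
  | zero => simp only [tensorHom_zero, zero_comp, comp_zero]
  | add x y hx hy => simp only [tensorHom_add, Preadditive.add_comp, Preadditive.comp_add, hx, hy]
  | smul c x hx => simp only [tensorHom_smul, Linear.smul_comp, Linear.comp_smul, hx]
  | h t a b =>
    have h : IsProd (terminal.from t) (𝟙 t) :=
      ⟨fun _ _ _ _ h => by simpa using h, fun s f g => ⟨g, by ext, by simp⟩⟩
    rw [id_unit, msp_tensor _ _ _ _ h, msp_iso_hom, iso_hom_msp]
    simp only [leftUnitEl, El.pre_id, El.p2_pair]
    rw [El.eq_unit (El.pre _ _)]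

theorem rightUnit_nat (f : M ⟶ N) : tensorHom f (𝟙 (tensorUnit δ)) ≫ (rightUnitEl N).iso.hom =
    (rightUnitEl M).iso.hom ≫ f := by
  induction f using msp_induction with
  | zero => simp only [zero_tensorHom, zero_comp, comp_zero]
  | add x y hx hy => simp only [add_tensorHom, Preadditive.add_comp, Preadditive.comp_add, hx, hy]
  | smul c x hx => simp only [smul_tensorHom, Linear.smul_comp, Linear.comp_smul, hx]
  | h t a b =>
    have h : IsProd (𝟙 t) (terminal.from t) :=
      ⟨fun _ _ _ h _ => by simpa using h, fun s f g => ⟨f, by simp, by ext⟩⟩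
    rw [id_unit, msp_tensor _ _ _ _ h, msp_iso_hom, iso_hom_msp]
    simp only [rightUnitEl, El.pre_id, El.p1_pair]
    rw [El.eq_unit (El.pre _ _)]

theorem braid_nat (f : M ⟶ N) (g : P ⟶ Q) : tensorHom f g ≫ (braidEl N Q).iso.hom =
    (braidEl M P).iso.hom ≫ tensorHom g f := by
  induction f using msp_induction with
  | zero => simp only [zero_tensorHom, tensorHom_zero, zero_comp, comp_zero]
  | add x y hx hy =>
    simp only [add_tensorHom, tensorHom_add, Preadditive.add_comp, Preadditive.comp_add, hx, hy]
  | smul c x hx =>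
    simp only [smul_tensorHom, tensorHom_smul, Linear.smul_comp, Linear.comp_smul, hx]
  | h t a b =>
  induction g using msp_induction with
  | zero => simp only [zero_tensorHom, tensorHom_zero, zero_comp, comp_zero]
  | add x y hx hy =>
    simp only [add_tensorHom, tensorHom_add, Preadditive.add_comp, Preadditive.comp_add, hx, hy]
  | smul c x hx =>
    simp only [smul_tensorHom, tensorHom_smul, Linear.smul_comp, Linear.comp_smul, hx]
  | h t' c d =>
    by_cases H : ∃ (s : A) (_ : s ⟶ t) (_ : s ⟶ t'), True
    · obtain ⟨s, f₁, f₂, -⟩ := H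
      obtain ⟨W, p₁, p₂, hW⟩ := exists_isProd f₁ f₂
      have hW' : IsProd p₂ p₁ := ⟨fun _ _ _ h1 h2 => hW.jm _ _ h2 h1, fun T x y => by
        obtain ⟨l, h1, h2⟩ := hW.exists_lift y x
        exact ⟨l, h2, h1⟩⟩
      rw [msp_tensor _ _ _ _ hW, msp_tensor _ _ _ _ hW', msp_iso_hom, iso_hom_msp]
      simp only [braidEl, El.p1_pair, El.p2_pair]
    · rw [msp_tensor_zero a b c d fun s f g => H ⟨s, f, g, trivial⟩,
        msp_tensor_zero c d a b fun s f g => H ⟨s, g, f, trivial⟩, zero_comp, comp_zero]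

theorem tensorHom_id_id (M N : Mat_ (T0 δ)) : tensorHom (𝟙 M) (𝟙 N) = 𝟙 (tensorObj M N) := by
  rw [← gr_ElHom_id, ← gr_ElHom_id, gr_tensor]
  exact gr_id fun _ a => El.pair_eta a

noncomputable instance matMonoidalStruct : MonoidalCategoryStruct (Mat_ (T0 δ)) where
  tensorObj := tensorObj
  tensorUnit := tensorUnit δ
  tensorHom := tensorHom
  whiskerLeft M _ _ f := tensorHom (𝟙 M) f
  whiskerRight f N := tensorHom f (𝟙 N)
  associator M N P := (assocEl M N P).iso
  leftUnitor M := (leftUnitEl M).iso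
  rightUnitor M := (rightUnitEl M).iso

noncomputable instance matMonoidal : MonoidalCategory (Mat_ (T0 δ)) :=
  MonoidalCategory.ofTensorHom
    (id_tensorHom_id := tensorHom_id_id)
    (id_tensorHom := fun _ _ _ _ => rfl)
    (tensorHom_id := fun _ _ => rfl)
    (tensorHom_comp_tensorHom := tensor_comp)
    (associator_naturality := assoc_nat)
    (leftUnitor_naturality := leftUnit_nat)
    (rightUnitor_naturality := rightUnit_nat)
    (pentagon := fun M N P Q => by
      change tensorHom (gr _) (𝟙 Q) ≫ gr _ ≫ tensorHom (𝟙 M) (gr _) = gr _ ≫ gr _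
      rw [← gr_ElHom_id, ← gr_ElHom_id, gr_tensor, gr_tensor, gr_comp, gr_comp, gr_comp]
      refine gr_congr fun t a => ?_
      simp only [ElHom.comp, ElHom.prod, ElHom.id, assocEl, El.p1_pair, El.p2_pair])
    (triangle := fun M N => by
      change gr _ ≫ tensorHom (𝟙 M) (gr _) = tensorHom (gr _) (𝟙 N)
      rw [← gr_ElHom_id, ← gr_ElHom_id, gr_tensor, gr_tensor, gr_comp]
      refine gr_congr fun t a => ?_
      simp only [ElHom.comp, ElHom.prod, ElHom.id, assocEl, leftUnitEl, rightUnitEl, El.p1_pair,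
        El.p2_pair])

noncomputable instance matSymmetric : SymmetricCategory (Mat_ (T0 δ)) where
  braiding M N := (braidEl M N).iso
  braiding_naturality_right M _ _ f := braid_nat (𝟙 M) f
  braiding_naturality_left f N := braid_nat f (𝟙 N)
  hexagon_forward M N P := by
    change gr _ ≫ gr _ ≫ gr _ = tensorHom (gr _) (𝟙 P) ≫ gr _ ≫ tensorHom (𝟙 N) (gr _)
    rw [← gr_ElHom_id, ← gr_ElHom_id, gr_tensor, gr_tensor, gr_comp, gr_comp, gr_comp, gr_comp]
    refine gr_congr fun t a => ?_
    simp only [ElHom.comp, ElHom.prod, ElHom.id, assocEl, braidEl, El.p1_pair, El.p2_pair]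
  hexagon_reverse M N P := by
    change gr _ ≫ gr _ ≫ gr _ = tensorHom (𝟙 M) (gr _) ≫ gr _ ≫ tensorHom (gr _) (𝟙 N)
    rw [← gr_ElHom_id, ← gr_ElHom_id, gr_tensor, gr_tensor, gr_comp, gr_comp, gr_comp, gr_comp]
    refine gr_congr fun t a => ?_
    simp only [ElHom.comp, ElHom.prod, ElHom.id, assocEl, braidEl, El.p1_pair, El.p2_pair]
  symmetry M N := by
    change gr _ ≫ gr _ = 𝟙 (tensorObj M N)
    rw [gr_comp]
    exact gr_id fun _ a => (braidEl M N).hom_inv _ a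

end MatMonoidalCategory

section KaroubiMonoidal

open MonoidalCategory Idempotents

variable {C : Type u} [Category.{v} C]

/-- The morphism `p ≫ f = f ≫ q` of formal direct factors `(X, p) ⟶ (Y, q)` given by a morphism
`f : X ⟶ Y` which commutes with the idempotents. -/
def klift {X Y : Karoubi C} (f : X.X ⟶ Y.X) (h : X.p ≫ f = f ≫ Y.p) : X ⟶ Y :=
  ⟨X.p ≫ f, by rw [Category.assoc, ← h, X.idem_assoc, X.idem_assoc]⟩

theorem klift_comp {X Y Z : Karoubi C} (f : X.X ⟶ Y.X) (h : X.p ≫ f = f ≫ Y.p) (g : Y.X ⟶ Z.X)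
    (h' : Y.p ≫ g = g ≫ Z.p) : klift f h ≫ klift g h' =
      klift (f ≫ g) (by rw [reassoc_of% h, h', Category.assoc]) := by
  ext
  change (X.p ≫ f) ≫ Y.p ≫ g = X.p ≫ f ≫ g
  rw [Category.assoc, ← reassoc_of% h, X.idem_assoc]

theorem klift_id (X : Karoubi C) : klift (𝟙 X.X) (by simp) = 𝟙 X :=
  Karoubi.hom_ext _ _ (Category.comp_id _)

theorem klift_congr {X Y : Karoubi C} {f g : X.X ⟶ Y.X} (hfg : f = g) (h : X.p ≫ f = f ≫ Y.p)
    (h' : X.p ≫ g = g ≫ Y.p) : klift f h = klift g h' := by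
  subst hfg
  rfl

theorem comp_klift_f {X Y Z : Karoubi C} (f : X ⟶ Y) (g : Y.X ⟶ Z.X) (h : Y.p ≫ g = g ≫ Z.p) :
    (f ≫ klift g h).f = f.f ≫ g := by
  change f.f ≫ Y.p ≫ g = _
  rw [Karoubi.comp_p_assoc]

theorem klift_comp_f {X Y Z : Karoubi C} (f : X.X ⟶ Y.X) (h : X.p ≫ f = f ≫ Y.p) (g : Y ⟶ Z) :
    (klift f h ≫ g).f = f ≫ g.f := by
  change (X.p ≫ f) ≫ g.f = _
  rw [h, Category.assoc, Karoubi.p_comp]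

/-- The isomorphism of formal direct factors given by an isomorphism which commutes with the
idempotents. -/
def kliftIso {X Y : Karoubi C} (f : X.X ≅ Y.X) (h : X.p ≫ f.hom = f.hom ≫ Y.p) : X ≅ Y where
  hom := klift f.hom h
  inv := klift f.inv (by rw [Iso.eq_inv_comp, ← reassoc_of% h, Iso.hom_inv_id,
    Category.comp_id])
  hom_inv_id := by
    rw [klift_comp, ← klift_id]
    exact klift_congr f.hom_inv_id _ _
  inv_hom_id := by
    rw [klift_comp, ← klift_id]
    exact klift_congr f.inv_hom_id _ _

variable [MonoidalCategory C]

/-- Tensor product of formal direct factors: `(X, p) ⊗ (Y, q) = (X ⊗ Y, p ⊗ q)`. -/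
abbrev ktensor (X Y : Karoubi C) : Karoubi C :=
  ⟨X.X ⊗ Y.X, X.p ⊗ₘ Y.p, by rw [tensorHom_comp_tensorHom, X.idem, Y.idem]⟩

/-- Tensor product of morphisms of formal direct factors. -/
def ktensorHom {X Y X' Y' : Karoubi C} (f : X ⟶ Y) (g : X' ⟶ Y') : ktensor X X' ⟶ ktensor Y Y' :=
  ⟨f.f ⊗ₘ g.f, by simp only [ktensor, tensorHom_comp_tensorHom, f.comm, g.comm]⟩

theorem klift_tensor {X Y X' Y' : Karoubi C} (f : X.X ⟶ Y.X) (h : X.p ≫ f = f ≫ Y.p)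
    (g : X'.X ⟶ Y'.X) (h' : X'.p ≫ g = g ≫ Y'.p) : ktensorHom (klift f h) (klift g h') =
      klift (X := ktensor X X') (Y := ktensor Y Y') (f ⊗ₘ g)
        (by simp only [ktensor, tensorHom_comp_tensorHom, h, h']) :=
  Karoubi.hom_ext _ _ (tensorHom_comp_tensorHom _ _ _ _).symm

/-- The unit of the Karoubi envelope. -/
abbrev kunit : Karoubi C := ⟨𝟙_ C, 𝟙 _, Category.comp_id _⟩

theorem kassoc_comm (X Y Z : Karoubi C) : (ktensor (ktensor X Y) Z).p ≫ (α_ X.X Y.X Z.X).hom =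
    (α_ X.X Y.X Z.X).hom ≫ (ktensor X (ktensor Y Z)).p := associator_naturality _ _ _

theorem kleft_comm (X : Karoubi C) : (ktensor kunit X).p ≫ (λ_ X.X).hom = (λ_ X.X).hom ≫ X.p :=
  (congrArg (· ≫ (λ_ X.X).hom) (id_tensorHom (𝟙_ C) X.p)).trans (leftUnitor_naturality X.p)

theorem kright_comm (X : Karoubi C) : (ktensor X kunit).p ≫ (ρ_ X.X).hom = (ρ_ X.X).hom ≫ X.p :=
  (congrArg (· ≫ (ρ_ X.X).hom) (tensorHom_id X.p (𝟙_ C))).trans (rightUnitor_naturality X.p)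

/-- The associator. -/
abbrev kassoc (X Y Z : Karoubi C) : ktensor (ktensor X Y) Z ⟶ ktensor X (ktensor Y Z) :=
  klift (α_ X.X Y.X Z.X).hom (kassoc_comm X Y Z)

/-- The left unitor. -/
abbrev kleft (X : Karoubi C) : ktensor kunit X ⟶ X := klift (λ_ X.X).hom (kleft_comm X)

/-- The right unitor. -/
abbrev kright (X : Karoubi C) : ktensor X kunit ⟶ X := klift (ρ_ X.X).hom (kright_comm X)

/-- The monoidal structure on the Karoubi envelope of a monoidal category. -/
instance karoubiMonoidalStruct : MonoidalCategoryStruct (Karoubi C) where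
  tensorObj := ktensor
  tensorUnit := kunit
  tensorHom := ktensorHom
  whiskerLeft X _ _ f := ktensorHom (𝟙 X) f
  whiskerRight f Y := ktensorHom f (𝟙 Y)
  associator X Y Z := kliftIso (α_ X.X Y.X Z.X) (kassoc_comm X Y Z)
  leftUnitor X := kliftIso (λ_ X.X) (kleft_comm X)
  rightUnitor X := kliftIso (ρ_ X.X) (kright_comm X)

theorem kassoc_nat {X₁ X₂ X₃ Y₁ Y₂ Y₃ : Karoubi C} (f₁ : X₁ ⟶ Y₁) (f₂ : X₂ ⟶ Y₂) (f₃ : X₃ ⟶ Y₃) :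
    ktensorHom (ktensorHom f₁ f₂) f₃ ≫ (kassoc Y₁ Y₂ Y₃) =
      (kassoc X₁ X₂ X₃) ≫ ktensorHom f₁ (ktensorHom f₂ f₃) := by
  refine Karoubi.hom_ext _ _ <| (comp_klift_f _ _ _).trans <|
    Eq.trans ?_ (klift_comp_f _ _ _).symm
  exact associator_naturality f₁.f f₂.f f₃.f

theorem kleft_nat {X Y : Karoubi C} (f : X ⟶ Y) :
    ktensorHom (𝟙 kunit) f ≫ (kleft Y) = (kleft X) ≫ f := by
  refine Karoubi.hom_ext _ _ <| (comp_klift_f _ _ _).trans <|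
    Eq.trans ?_ (klift_comp_f _ _ _).symm
  exact (congrArg (· ≫ (λ_ Y.X).hom) (id_tensorHom (𝟙_ C) f.f)).trans (leftUnitor_naturality f.f)

theorem kright_nat {X Y : Karoubi C} (f : X ⟶ Y) :
    ktensorHom f (𝟙 kunit) ≫ (kright Y) = (kright X) ≫ f := by
  refine Karoubi.hom_ext _ _ <| (comp_klift_f _ _ _).trans <|
    Eq.trans ?_ (klift_comp_f _ _ _).symm
  exact (congrArg (· ≫ (ρ_ Y.X).hom) (tensorHom_id f.f (𝟙_ C))).trans (rightUnitor_naturality f.f)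

theorem kpentagon (W X Y Z : Karoubi C) :
    ktensorHom (kassoc W X Y) (𝟙 Z) ≫ (kassoc W (ktensor X Y) Z) ≫
        ktensorHom (𝟙 W) (kassoc X Y Z) =
      (kassoc (ktensor W X) Y Z) ≫ (kassoc W X (ktensor Y Z)) := by
  rw [← klift_id, ← klift_id, klift_tensor, klift_tensor, klift_comp, klift_comp, klift_comp]
  refine klift_congr ?_ _ _
  rw [tensorHom_id, id_tensorHom]
  exact MonoidalCategory.pentagon W.X X.X Y.X Z.X

theorem ktriangle (X Y : Karoubi C) :
    (kassoc X kunit Y) ≫ ktensorHom (𝟙 X) (kleft Y) =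
      ktensorHom (kright X) (𝟙 Y) := by
  rw [← klift_id, ← klift_id, klift_tensor, klift_tensor, klift_comp]
  refine klift_congr ?_ _ _
  rw [tensorHom_id, id_tensorHom]
  exact MonoidalCategory.triangle X.X Y.X

instance karoubiMonoidal : MonoidalCategory (Karoubi C) :=
  MonoidalCategory.ofTensorHom
    (id_tensorHom_id := fun _ _ => rfl)
    (id_tensorHom := fun _ _ _ _ => rfl)
    (tensorHom_id := fun _ _ => rfl)
    (tensorHom_comp_tensorHom := fun f₁ f₂ g₁ g₂ =>
      Karoubi.hom_ext _ _ (tensorHom_comp_tensorHom f₁.f f₂.f g₁.f g₂.f))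
    (associator_naturality := kassoc_nat)
    (leftUnitor_naturality := kleft_nat)
    (rightUnitor_naturality := kright_nat)
    (pentagon := kpentagon)
    (triangle := ktriangle)

theorem kassoc_inv_comm (X Y Z : Karoubi C) : (ktensor X (ktensor Y Z)).p ≫ (α_ X.X Y.X Z.X).inv =
    (α_ X.X Y.X Z.X).inv ≫ (ktensor (ktensor X Y) Z).p := associator_inv_naturality _ _ _

section

variable [SymmetricCategory C]

theorem kbraid_comm (X Y : Karoubi C) : (ktensor X Y).p ≫ (β_ X.X Y.X).hom =
    (β_ X.X Y.X).hom ≫ (ktensor Y X).p := BraidedCategory.braiding_naturality _ _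

/-- The braiding. -/
abbrev kbraid (X Y : Karoubi C) : ktensor X Y ⟶ ktensor Y X :=
  klift (β_ X.X Y.X).hom (kbraid_comm X Y)

theorem kbraid_nat {X Y X' Y' : Karoubi C} (f : X ⟶ Y) (g : X' ⟶ Y') :
    ktensorHom f g ≫ (kbraid Y Y') = (kbraid X X') ≫ ktensorHom g f := by
  refine Karoubi.hom_ext _ _ <| (comp_klift_f _ _ _).trans <|
    Eq.trans ?_ (klift_comp_f _ _ _).symm
  exact BraidedCategory.braiding_naturality f.f g.f

/-- The inverse associator. -/
abbrev kassoc_inv (X Y Z : Karoubi C) : ktensor X (ktensor Y Z) ⟶ ktensor (ktensor X Y) Z :=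
  klift (α_ X.X Y.X Z.X).inv (kassoc_inv_comm X Y Z)

theorem khexagon_forward (X Y Z : Karoubi C) :
    (kassoc X Y Z) ≫ (kbraid X (ktensor Y Z)) ≫
        (kassoc Y Z X) =
      ktensorHom (kbraid X Y) (𝟙 Z) ≫ (kassoc Y X Z) ≫
        ktensorHom (𝟙 Y) (kbraid X Z) := by
  rw [← klift_id, ← klift_id, klift_tensor, klift_tensor, klift_comp, klift_comp, klift_comp,
    klift_comp]
  refine klift_congr ?_ _ _
  rw [tensorHom_id, id_tensorHom]
  exact BraidedCategory.hexagon_forward X.X Y.X Z.X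

theorem khexagon_reverse (X Y Z : Karoubi C) :
    (kassoc_inv X Y Z) ≫ (kbraid (ktensor X Y) Z) ≫
        (kassoc_inv Z X Y) =
      ktensorHom (𝟙 X) (kbraid Y Z) ≫ (kassoc_inv X Z Y) ≫
        ktensorHom (kbraid X Z) (𝟙 Y) := by
  rw [← klift_id, ← klift_id, klift_tensor, klift_tensor, klift_comp, klift_comp, klift_comp,
    klift_comp]
  refine klift_congr ?_ _ _
  rw [tensorHom_id, id_tensorHom]
  exact BraidedCategory.hexagon_reverse X.X Y.X Z.X

theorem ksymmetry (X Y : Karoubi C) :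
    (kbraid X Y) ≫ (kbraid Y X) = 𝟙 (ktensor X Y) := by
  rw [klift_comp, ← klift_id]
  exact klift_congr (SymmetricCategory.symmetry X.X Y.X) _ _

/-- The symmetric structure on the Karoubi envelope of a symmetric monoidal category. -/
instance karoubiSymmetric : SymmetricCategory (Karoubi C) where
  braiding X Y := kliftIso (β_ X.X Y.X) (kbraid_comm X Y)
  braiding_naturality_right X _ _ f := kbraid_nat (𝟙 X) f
  braiding_naturality_left f Z := kbraid_nat f (𝟙 Z)
  hexagon_forward := khexagon_forward
  hexagon_reverse := khexagon_reverse
  symmetry := ksymmetry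

end

end KaroubiMonoidal

end Knop

namespace Knop

universe w v u v' u'

section SkeletalMonoidal

open MonoidalCategory

variable {K : Type w} [Field K] {A : Type u} [Category.{v} A] [RegularCategory A]
  (δ : DegreeFunction K A)

/-- The one-element family `[x]`. -/
noncomputable abbrev emb (x : T0 δ) : Mat_ (T0 δ) := (Mat_.embedding (T0 δ)).obj x

variable {δ} [HasBinaryProducts A]

/-- `[x] ⊗ [y]` is `[x × y]`. -/
noncomputable def embEl (x y : T0 δ) :
    ElIso (tensorObj (emb δ x) (emb δ y)) (emb δ (T0.of (x.obj ⨯ y.obj))) where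
  hom := ⟨fun a => ⟨PUnit.unit, a.mor⟩, fun _ _ => rfl⟩
  inv := ⟨fun a => ⟨⟨(PUnit.unit, PUnit.unit), inferInstanceAs (HasBinaryProduct x.obj y.obj)⟩,
    a.mor⟩, fun _ _ => rfl⟩
  hom_inv _ _ := rfl
  inv_hom _ _ := rfl

/-- The tensor product of morphisms of `T⁰(A, δ)`. -/
noncomputable def skTens {x y x' y' : T0 δ} (f : x ⟶ y) (g : x' ⟶ y') :
    (T0.of (x.obj ⨯ x'.obj) : T0 δ) ⟶ T0.of (y.obj ⨯ y'.obj) :=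
  tens δ x.obj y.obj x'.obj y'.obj f g

/-- `skTens`, on one-by-one matrices. -/
noncomputable def etens {x y x' y' : T0 δ} (F : emb δ x ⟶ emb δ y) (G : emb δ x' ⟶ emb δ y') :
    emb δ (T0.of (x.obj ⨯ x'.obj)) ⟶ emb δ (T0.of (y.obj ⨯ y'.obj)) :=
  (Mat_.embedding (T0 δ)).map ((skTens (F PUnit.unit PUnit.unit : x ⟶ y)
    (G PUnit.unit PUnit.unit : x' ⟶ y')))

theorem etens_msp {x y x' y' : T0 δ} {t t' : A} (a : El (emb δ x) t) (b : El (emb δ y) t)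
    (c : El (emb δ x') t') (d : El (emb δ y') t') : etens (msp a b) (msp c d) =
      msp (⟨PUnit.unit, prod.lift (prod.fst ≫ a.mor) (prod.snd ≫ c.mor)⟩ :
          El (emb δ (T0.of (x.obj ⨯ x'.obj))) (t ⨯ t'))
        (⟨PUnit.unit, prod.lift (prod.fst ≫ b.mor) (prod.snd ≫ d.mor)⟩ :
          El (emb δ (T0.of (y.obj ⨯ y'.obj))) (t ⨯ t')) := by
  obtain ⟨⟨⟩, a⟩ := a
  obtain ⟨⟨⟩, b⟩ := b
  obtain ⟨⟨⟩, c⟩ := c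
  obtain ⟨⟨⟩, d⟩ := d
  funext i j
  refine Eq.trans ?_ (place_same (M := emb δ (T0.of (x.obj ⨯ x'.obj)))
    (N := emb δ (T0.of (y.obj ⨯ y'.obj))) PUnit.unit PUnit.unit _).symm
  refine Eq.trans ?_ ((goodTens δ a b c d).1 _ _ (isProd_prod t t'))
  exact congrArg₂ (fun f g => tens δ x.obj y.obj x'.obj y'.obj f g)
    (place_same (M := emb δ x) (N := emb δ y) PUnit.unit PUnit.unit _)
    (place_same (M := emb δ x') (N := emb δ y') PUnit.unit PUnit.unit _)

theorem etens_zero {x y x' y' : T0 δ} (F : emb δ x ⟶ emb δ y) :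
    etens F (0 : emb δ x' ⟶ emb δ y') = 0 := by
  funext i j
  exact map_zero (tens δ x.obj y.obj x'.obj y'.obj _)

theorem etens_add {x y x' y' : T0 δ} (F : emb δ x ⟶ emb δ y) (G H : emb δ x' ⟶ emb δ y') :
    etens F (G + H) = etens F G + etens F H := by
  funext i j
  exact map_add (tens δ x.obj y.obj x'.obj y'.obj _) _ _

theorem etens_smul {x y x' y' : T0 δ} (c : K) (F : emb δ x ⟶ emb δ y)
    (G : emb δ x' ⟶ emb δ y') : etens F (c • G) = c • etens F G := by
  funext i j
  exact map_smul (tens δ x.obj y.obj x'.obj y'.obj _) _ _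

theorem zero_etens {x y x' y' : T0 δ} (G : emb δ x' ⟶ emb δ y') :
    etens (0 : emb δ x ⟶ emb δ y) G = 0 := by
  funext i j
  exact LinearMap.map_zero₂ (tens δ x.obj y.obj x'.obj y'.obj) _

theorem add_etens {x y x' y' : T0 δ} (F H : emb δ x ⟶ emb δ y) (G : emb δ x' ⟶ emb δ y') :
    etens (F + H) G = etens F G + etens H G := by
  funext i j
  exact LinearMap.map_add₂ (tens δ x.obj y.obj x'.obj y'.obj) _ _ _

theorem smul_etens {x y x' y' : T0 δ} (c : K) (F : emb δ x ⟶ emb δ y)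
    (G : emb δ x' ⟶ emb δ y') : etens (c • F) G = c • etens F G := by
  funext i j
  exact LinearMap.map_smul₂ (tens δ x.obj y.obj x'.obj y'.obj) _ _ _

theorem emb_tens_aux {x y x' y' : T0 δ} (F : emb δ x ⟶ emb δ y) (G : emb δ x' ⟶ emb δ y') :
    tensorHom F G ≫ (embEl y y').iso.hom = (embEl x x').iso.hom ≫ etens F G := by
  induction F using msp_induction with
  | zero => simp only [zero_tensorHom, zero_etens, zero_comp, comp_zero]
  | add a b ha hb =>
    simp only [add_tensorHom, add_etens, Preadditive.add_comp, Preadditive.comp_add, ha, hb]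
  | smul c a ha => simp only [smul_tensorHom, smul_etens, Linear.smul_comp, Linear.comp_smul, ha]
  | h t a b =>
  induction G using msp_induction with
  | zero => simp only [tensorHom_zero, etens_zero, zero_comp, comp_zero]
  | add c d hc hd =>
    simp only [tensorHom_add, etens_add, Preadditive.add_comp, Preadditive.comp_add, hc, hd]
  | smul c d hd => simp only [tensorHom_smul, etens_smul, Linear.smul_comp, Linear.comp_smul, hd]
  | h t' c d =>
    rw [msp_tensor _ _ _ _ (isProd_prod t t'), msp_iso_hom, etens_msp, iso_hom_msp]
    rfl

theorem emb_tens {x y x' y' : T0 δ} (f : x ⟶ y) (g : x' ⟶ y') :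
    (Mat_.embedding (T0 δ)).map (skTens f g) = (embEl x x').iso.inv ≫
      ((Mat_.embedding (T0 δ)).map f ⊗ₘ (Mat_.embedding (T0 δ)).map g) ≫ (embEl y y').iso.hom := by
  rw [Iso.eq_inv_comp]
  exact (emb_tens_aux ((Mat_.embedding (T0 δ)).map f) ((Mat_.embedding (T0 δ)).map g)).symm

variable (δ) in
/-- The unit object of `Mat_ (T0 δ)` is the one-element family `[⊤_ A]`. -/
noncomputable def embUnit : 𝟙_ (Mat_ (T0 δ)) ≅ emb δ (T0.of (⊤_ A)) := Iso.refl _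

/-- If `A` has binary products, `T⁰(A, δ)` has the tensor product `[x] ⊗ [y] = [x × y]`, with unit
`[1]` and with the same structure morphisms as one-element families. -/
noncomputable instance skMonoidalStruct : MonoidalCategoryStruct (T0 δ) where
  tensorObj x y := T0.of (x.obj ⨯ y.obj)
  tensorUnit := T0.of (⊤_ A)
  tensorHom := skTens
  whiskerLeft x _ _ f := skTens (𝟙 x) f
  whiskerRight f y := skTens f (𝟙 y)
  associator x y z := (Mat_.embedding (T0 δ)).preimageIso <|
    ((embEl _ z).iso.symm ≪≫ ((embEl x y).iso.symm ⊗ᵢ .refl _)) ≪≫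
      α_ (emb δ x) (emb δ y) (emb δ z) ≪≫ ((.refl _ ⊗ᵢ (embEl y z).iso) ≪≫ (embEl x _).iso)
  leftUnitor x := (Mat_.embedding (T0 δ)).preimageIso <|
    ((embEl _ x).iso.symm ≪≫ ((embUnit δ).symm ⊗ᵢ .refl _)) ≪≫ λ_ (emb δ x)
  rightUnitor x := (Mat_.embedding (T0 δ)).preimageIso <|
    ((embEl x _).iso.symm ≪≫ (.refl _ ⊗ᵢ (embUnit δ).symm)) ≪≫ ρ_ (emb δ x)

variable (δ) in
/-- The embedding of `T⁰(A, δ)` in its additive envelope is compatible with tensor products. -/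
noncomputable def skData : Monoidal.InducingFunctorData (Mat_.embedding (T0 δ)) where
  μIso x y := (embEl x y).iso
  εIso := embUnit δ
  tensorHom_eq f g := emb_tens f g
  whiskerLeft_eq x _ _ f := by
    refine (emb_tens (𝟙 x) f).trans ?_
    rw [CategoryTheory.Functor.map_id, MonoidalCategory.id_tensorHom]
  whiskerRight_eq f y := by
    refine (emb_tens f (𝟙 y)).trans ?_
    rw [CategoryTheory.Functor.map_id, MonoidalCategory.tensorHom_id]
  associator_eq _ _ _ := (Mat_.embedding (T0 δ)).map_preimage _
  leftUnitor_eq _ := (Mat_.embedding (T0 δ)).map_preimage _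
  rightUnitor_eq _ := (Mat_.embedding (T0 δ)).map_preimage _

noncomputable instance skMonoidal : MonoidalCategory (T0 δ) :=
  Monoidal.induced (Mat_.embedding (T0 δ)) (skData δ)

noncomputable instance embMonoidal : (Mat_.embedding (T0 δ)).Monoidal :=
  Monoidal.fromInducedMonoidal (Mat_.embedding (T0 δ)) (skData δ)

noncomputable instance skSymmetric : SymmetricCategory (T0 δ) :=
  SymmetricCategory.ofFullyFaithful (Mat_.embedding (T0 δ))

end SkeletalMonoidal

section Functoriality

/-- The additive Karoubi envelope `T(A, δ)` of `T⁰(A, δ)`: first finite families of objects and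
matrices of morphisms, then formal direct factors. -/
noncomputable abbrev T {K : Type w} [Field K] {A : Type u} [Category.{v} A] [RegularCategory A]
    (δ : DegreeFunction K A) := Idempotents.Karoubi (Mat_ (T0 δ))

/-- The embedding of `T⁰(A, δ)` in its additive Karoubi envelope. -/
noncomputable abbrev toT {K : Type w} [Field K] {A : Type u} [Category.{v} A] [RegularCategory A]
    (δ : DegreeFunction K A) : T0 δ ⥤ T δ :=
  Mat_.embedding (T0 δ) ⋙ Idempotents.toKaroubi (Mat_ (T0 δ))

variable {A : Type u} [Category.{v} A] {A' : Type u'} [Category.{v'} A']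

/-- `F` preserves (possibly non-existing) pullbacks: `F (x ×_z y) = F x ×_(F z) F y`, where either
side exists if the other does. -/
structure PreservesPullbacks (F : A ⥤ A') : Prop where
  preserves : PreservesLimitsOfShape WalkingCospan F
  hasPullback {x y z : A} (f : x ⟶ z) (g : y ⟶ z) :
    HasPullback (F.map f) (F.map g) → HasPullback f g

/-- `F` preserves the degree functions: it preserves (extremal) epimorphisms and their degrees. -/
structure PreservesDegree {K : Type w} [Field K] (δ : DegreeFunction K A)
    (δ' : DegreeFunction K A') (F : A ⥤ A') : Prop where
  extremalEpi {x y : A} (e : x ⟶ y) : ExtremalEpi e → ExtremalEpi (F.map e)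
  deg_map {x y : A} (e : x ⟶ y) (h : ExtremalEpi e) (h' : ExtremalEpi (F.map e)) :
    δ'.deg (F.map e) h' = δ.deg e h

end Functoriality

end Knop

/-!
A functor `F` which preserves pullbacks and degrees acts on relations. It preserves joint
monicity although it need not preserve products: `F (x × y)` is the fibre product of `F x` and
`F y` over `F 1`, so its two projections are still jointly monic, and `F` preserves monomorphisms
(`PreservesPullbacks.map_jm`). Since `F` preserves extremal epimorphisms and their degrees, the
action on relations carries the combination `δ(e) ⟨im⟩` attached to an arbitrary pair `x ⟵ w ⟶ y`
to the one attached to `F x ⟵ F w ⟶ F y` (`relMap_sp`). Composition of pairs is given by pullback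
when there is one, and is zero otherwise; `F` preserves both cases, as it preserves the existence
and the non-existence of pullbacks (`relMap_comp`). This gives the functor `T0.map`, and entrywise
`matMap` on finite families of objects, `T.map` on their formal direct factors.

If `F 1` is terminal, then `F` preserves and reflects the existence of binary products. In terms
of the points `t ⟶ xᵢ` of a family `(xᵢ)ᵢ`, pairs of points of the images of `M` and `N` then
correspond bijectively to points of the image of `M ⊗ N`. This bijection is the tensorator of
`matMap` (`tensoratorEl`), it is natural on the generating morphisms (`tensorator_nat`), and the
coherence conditions reduce to identities between projections of points (`matMapCoreMonoidal`,
`matMapBraided`). A symmetric monoidal functor extends to formal direct factors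
(`karoubiMapBraided`). If all products exist, `T⁰` embeds fully faithfully and monoidally in the
category of finite families, and the structure on `matMap` restricts to `T0.map`
(`braidedOfComp`).

That `F` preserves every finite limit which exists in `A` once it preserves the terminal object is
seen in the category of objects under the apex `l` of the limit cone: this has a terminal object,
and also all pullbacks, since `l` completes each cospan to a commutative square
(`PreservesPullbacks.preservesFiniteLimits`).
-/

namespace Knop

universe w v u v' u'

/-! ### The functor on relations -/

section RelationsImage

variable {A : Type u} [Category.{v} A] {A' : Type u'} [Category.{v'} A'] {F : A ⥤ A'}

theorem PreservesPullbacks.map_isPullback (hpb : PreservesPullbacks F) {w x y z : A} {p : w ⟶ x}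
    {q : w ⟶ y} {f : x ⟶ z} {g : y ⟶ z} (h : IsPullback p q f g) :
    IsPullback (F.map p) (F.map q) (F.map f) (F.map g) :=
  have := hpb.preserves
  h.map F

theorem PreservesPullbacks.map_mono (hpb : PreservesPullbacks F) {x y : A} (f : x ⟶ y) [Mono f] :
    Mono (F.map f) :=
  have := hpb.preserves
  inferInstance

/-- A commutative square over the image of a cospan forces a commutative square over the cospan
itself, because `F` reflects the existence of pullbacks. -/
theorem PreservesPullbacks.exists_comm [RegularCategory A'] (hpb : PreservesPullbacks F) {t : A'}
    {x y z : A} {f : x ⟶ z} {g : y ⟶ z} {p : t ⟶ F.obj x} {q : t ⟶ F.obj y}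
    (h : p ≫ F.map f = q ≫ F.map g) : ∃ (w : A) (p' : w ⟶ x) (q' : w ⟶ y), p' ≫ f = q' ≫ g :=
  have := hpb.hasPullback f g (RegularCategory.hasPullback_of_commSq h)
  ⟨_, _, _, pullback.condition⟩

variable [RegularCategory A]

theorem IsProd.isPullback {p x y : A} {a : p ⟶ x} {b : p ⟶ y} (h : IsProd a b) :
    IsPullback a b (terminal.from x) (terminal.from y) :=
  IsPullback.mk' (by ext) (fun _ _ _ h1 h2 => h.jm _ _ h1 h2)
    (fun _ f g _ => h.exists_lift f g)

/-- Although `F` need not preserve products, `F (x × y)` is still the fibre product of `F x` and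
`F y` over `F 1`; hence its projections are jointly monic. -/
theorem PreservesPullbacks.map_jm_of_isProd (hpb : PreservesPullbacks F) {p x y : A} {a : p ⟶ x}
    {b : p ⟶ y} (h : IsProd a b) : JM (F.map a) (F.map b) :=
  fun _ _ _ h1 h2 => (hpb.map_isPullback h.isPullback).hom_ext h1 h2

theorem PreservesPullbacks.map_isProd (hpb : PreservesPullbacks F) (hF : IsTerminal (F.obj (⊤_ A)))
    {p x y : A} {a : p ⟶ x} {b : p ⟶ y} (h : IsProd a b) : IsProd (F.map a) (F.map b) where
  jm := hpb.map_jm_of_isProd h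
  exists_lift t f g := by
    have hP := hpb.map_isPullback h.isPullback
    exact ⟨hP.lift f g (hF.hom_ext _ _), hP.lift_fst _ _ _, hP.lift_snd _ _ _⟩

theorem PreservesPullbacks.map_jm (hpb : PreservesPullbacks F) {r x y : A} {f : r ⟶ x} {g : r ⟶ y}
    (h : JM f g) : JM (F.map f) (F.map g) := by
  obtain ⟨p, a, b, hp⟩ := exists_isProd f g
  obtain ⟨l, rfl, rfl⟩ := hp.exists_lift f g
  have hl : Mono l := ⟨fun u v huv => h u v (by rw [reassoc_of% huv]) (by rw [reassoc_of% huv])⟩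
  have := hpb.map_mono l
  intro t u v h1 h2
  rw [← cancel_mono (F.map l)]
  exact hpb.map_jm_of_isProd hp _ _ (by simpa using h1) (by simpa using h2)

/-- The relation `F(r)` between `F(x)` and `F(y)`. -/
def Rel.map (hpb : PreservesPullbacks F) {x y : A} : Rel x y → Rel (F.obj x) (F.obj y) :=
  Quotient.map (fun R => ⟨F.obj R.apex, F.map R.fst, F.map R.snd, hpb.map_jm R.jm⟩) (by
    rintro R S ⟨i, h1, h2⟩
    exact ⟨F.mapIso i, by simp [← h1], by simp [← h2]⟩)

theorem Rel.map_graph (hpb : PreservesPullbacks F) {x y : A} (f : x ⟶ y) :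
    (Rel.graph f).map hpb = Rel.graph (F.map f) :=
  Rel.mk_eq (𝟙 (F.obj x)) (by simp) (by simp)

/-- The linear extension of `⟨r⟩ ↦ ⟨F(r)⟩`. -/
noncomputable def relMap (K : Type w) [Field K] (hpb : PreservesPullbacks F) (x y : A) :
    (Rel x y →₀ K) →ₗ[K] (Rel (F.obj x) (F.obj y) →₀ K) :=
  Finsupp.lmapDomain K K (Rel.map hpb)

variable {K : Type w} [Field K]

theorem relMap_single (hpb : PreservesPullbacks F) {x y : A} (r : Rel x y) (c : K) :
    relMap K hpb x y (Finsupp.single r c) = Finsupp.single (r.map hpb) c :=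
  Finsupp.mapDomain_single

variable [RegularCategory A'] {δ : DegreeFunction K A} {δ' : DegreeFunction K A'}

/-- The action on relations is computed on arbitrary pairs `x ⟵ w ⟶ y`, without passing to the image
of `w`: extremal epimorphisms, joint monicity and degrees are all preserved. -/
theorem relMap_sp (hdeg : PreservesDegree δ δ' F) (hpb : PreservesPullbacks F) {w x y : A}
    (f : w ⟶ x) (g : w ⟶ y) :
    relMap K hpb x y (sp δ f g) = sp δ' (F.map f) (F.map g) := by
  obtain ⟨R, e, he, rfl, rfl⟩ := exists_image f g
  rw [sp_eq δ he R.jm, relMap_single, F.map_comp, F.map_comp,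
    sp_eq δ' (hdeg.extremalEpi e he) (hpb.map_jm R.jm), hdeg.deg_map e he]
  rfl

/-- Either the fibre product exists and is preserved, or there is none, before and after applying
`F`, and both composites vanish. -/
theorem relMap_comp_sp (hdeg : PreservesDegree δ δ' F) (hpb : PreservesPullbacks F)
    {w w' x y z : A} (f : w ⟶ x) (g : w ⟶ y) (h : w' ⟶ y) (k : w' ⟶ z) :
    relMap K hpb x z (comp δ x y z (sp δ f g) (sp δ h k)) =
      comp δ' _ _ _ (relMap K hpb x y (sp δ f g)) (relMap K hpb y z (sp δ h k)) := by
  simp only [relMap_sp hdeg hpb]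
  by_cases H : ∃ (P : A) (p : P ⟶ w) (q : P ⟶ w'), p ≫ g = q ≫ h
  · obtain ⟨_, _, _, hc⟩ := H
    obtain ⟨P, p, q, hP⟩ := exists_isPullback hc
    rw [comp_sp δ hP, relMap_sp hdeg hpb, comp_sp δ' (hpb.map_isPullback hP), F.map_comp,
      F.map_comp]
  · push Not at H
    rw [comp_sp_zero δ H, map_zero, comp_sp_zero]
    intro t p q hc
    obtain ⟨P, p', q', hc'⟩ := hpb.exists_comm hc
    exact H P p' q' hc'

theorem relMap_comp (hdeg : PreservesDegree δ δ' F) (hpb : PreservesPullbacks F) {x y z : A}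
    (a : Rel x y →₀ K) (b : Rel y z →₀ K) :
    relMap K hpb x z (comp δ x y z a b) =
      comp δ' _ _ _ (relMap K hpb x y a) (relMap K hpb y z b) := by
  have hb : ∀ (w : A) (f : w ⟶ x) (g : w ⟶ y),
      relMap K hpb x z ∘ₗ comp δ x y z (sp δ f g) =
        comp δ' _ _ _ (relMap K hpb x y (sp δ f g)) ∘ₗ relMap K hpb y z := fun _ _ _ =>
    lin_ext δ fun _ _ _ => relMap_comp_sp hdeg hpb _ _ _ _
  have ha : relMap K hpb x z ∘ₗ (comp δ x y z).flip b =
      (comp δ' _ _ _).flip (relMap K hpb y z b) ∘ₗ relMap K hpb x y :=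
    lin_ext δ fun _ _ _ => LinearMap.congr_fun (hb _ _ _) b
  exact LinearMap.congr_fun ha a

/-- The functor `[x] ↦ [F(x)]`, `⟨r⟩ ↦ ⟨F(r)⟩` from `T⁰(A, δ)` to `T⁰(A', δ')`. -/
noncomputable def T0.map (hdeg : PreservesDegree δ δ' F) (hpb : PreservesPullbacks F) :
    T0 δ ⥤ T0 δ' where
  obj x := T0.of (F.obj x.obj)
  map {x y} a := relMap K hpb x.obj y.obj a
  map_id x := by
    refine (relMap_single hpb _ _).trans ?_
    rw [Rel.map_graph, F.map_id]
    rfl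
  map_comp a b := relMap_comp hdeg hpb a b

variable (hdeg : PreservesDegree δ δ' F) (hpb : PreservesPullbacks F)

instance T0.map_additive : (T0.map hdeg hpb).Additive where
  map_add {x y a b} := map_add (relMap K hpb x.obj y.obj) a b

instance T0.map_linear : (T0.map hdeg hpb).Linear K where
  map_smul {x y} a c := map_smul (relMap K hpb x.obj y.obj) c a

theorem T0.map_rel {r x y : A} (f : r ⟶ x) (g : r ⟶ y) (h : JM f g) :
    (T0.map hdeg hpb).map (T0.rel (Rel.mk f g h)) =
      T0.rel (Rel.mk (F.map f) (F.map g) (hpb.map_jm h)) :=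
  relMap_single hpb _ _

/-- The functor `T0.map` extends `F` along the graph functors. -/
noncomputable def T0.mapΓIso : F ⋙ Γ δ' ≅ Γ δ ⋙ T0.map hdeg hpb :=
  NatIso.ofComponents (fun _ => Iso.refl _) fun {x y} f => by
    refine (Category.comp_id _).trans (Eq.trans ?_ (Category.id_comp _).symm)
    refine Eq.trans ?_ (relMap_single hpb _ _).symm
    rw [Rel.map_graph]
    rfl

end RelationsImage

/-! ### Preservation of finite limits -/

section FiniteLimits

variable {A : Type u} [Category.{v} A] {A' : Type u'} [Category.{v'} A'] {F : A ⥤ A'}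
  [RegularCategory A]

/-- All pullbacks exist under a fixed object `l`: it completes every cospan to a commutative
square. -/
theorem hasLimit_cospan_under {l : A} (D : WalkingCospan ⥤ Under l) :
    HasLimit (D ⋙ Under.forget l) := by
  have h : HasPullback ((D ⋙ Under.forget l).map WalkingCospan.Hom.inl)
      ((D ⋙ Under.forget l).map WalkingCospan.Hom.inr) :=
    RegularCategory.hasPullback_of_commSq (p := (D.obj .left).hom) (q := (D.obj .right).hom)
      ((Under.w _).trans (Under.w _).symm)
  exact hasLimit_of_iso (diagramIsoCospan (D ⋙ Under.forget l)).symm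

theorem hasPullbacks_under (l : A) : HasPullbacks (Under l) where
  has_limit D :=
    have := hasLimit_cospan_under D
    inferInstance

/-- A limit cone with apex `l` is a limit cone in the category of objects under `l`, which has
a terminal object and pullbacks; `F` preserves both of them. -/
theorem PreservesPullbacks.preservesFiniteLimits (hpb : PreservesPullbacks F)
    (hF : IsTerminal (F.obj (⊤_ A))) : PreservesFiniteLimits F where
  preservesFiniteLimits J _ _ :=
    { preservesLimit := fun {D} =>
      { preserves := fun {c} hc => by
          have := hpb.preserves
          have h0 : PreservesLimit (Functor.empty.{0} A) F :=
            preservesLimit_of_preserves_limit_cone terminalIsTerminal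
              (isLimitChangeEmptyCone A' hF _ (Iso.refl _))
          have h1 : PreservesLimitsOfShape (Discrete.{0} PEmpty) F :=
            preservesLimitsOfShape_pempty_of_preservesTerminal F
          have := hasPullbacks_under c.pt
          have h2 : PreservesLimitsOfShape WalkingCospan (Under.forget c.pt) :=
            ⟨fun {D} => have := hasLimit_cospan_under D; inferInstance⟩
          have := preservesFiniteLimits_of_preservesTerminal_and_pullbacks (Under.forget c.pt ⋙ F)
          exact ⟨isLimitOfPreserves (Under.forget c.pt ⋙ F) (Under.isLimitToUnder hc)⟩ } }

theorem PreservesPullbacks.terminal_iff (hpb : PreservesPullbacks F) :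
    Nonempty (IsTerminal (F.obj (⊤_ A))) ↔ PreservesFiniteLimits F :=
  ⟨fun ⟨h⟩ => hpb.preservesFiniteLimits h, fun _ => ⟨terminalIsTerminal.isTerminalObj F _⟩⟩

end FiniteLimits

/-! ### The extension to finite families of objects -/

section MatBraided

open MonoidalCategory

variable {K : Type w} [Field K] {A : Type u} [Category.{v} A] {A' : Type u'} [Category.{v'} A']
  [RegularCategory A] [RegularCategory A'] {F : A ⥤ A'} {δ : DegreeFunction K A}
  {δ' : DegreeFunction K A'} (hdeg : PreservesDegree δ δ' F) (hpb : PreservesPullbacks F)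

/-- The extension of `T0.map` to finite families of objects, entry by entry. (`Functor.mapMat_`
does not apply, since the morphisms of `T0 δ` and of `T0 δ'` may live in different universes.) -/
noncomputable def matMap : Mat_ (T0 δ) ⥤ Mat_ (T0 δ') where
  obj M := ⟨M.ι, fun i => (T0.map hdeg hpb).obj (M.X i)⟩
  map f i j := (T0.map hdeg hpb).map (f i j)
  map_id M := by
    classical
    funext i j
    by_cases h : i = j
    · subst h
      refine (congrArg (T0.map hdeg hpb).map (Mat_.id_apply_self M i)).trans ?_
      exact ((T0.map hdeg hpb).map_id _).trans (Mat_.id_apply_self _ i).symm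
    · refine (congrArg (T0.map hdeg hpb).map (Mat_.id_apply_of_ne M i j h)).trans ?_
      exact ((T0.map hdeg hpb).map_zero _ _).trans (Mat_.id_apply_of_ne _ i j h).symm
  map_comp f g := by
    funext i k
    change (T0.map hdeg hpb).map (∑ j, f i j ≫ g j k) =
      ∑ j, (T0.map hdeg hpb).map (f i j) ≫ (T0.map hdeg hpb).map (g j k)
    rw [Functor.map_sum]
    exact Finset.sum_congr rfl fun j _ => (T0.map hdeg hpb).map_comp _ _

instance matMap_additive : (matMap hdeg hpb).Additive where
  map_add {M N a b} := by
    funext i j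
    exact (T0.map hdeg hpb).map_add (f := a i j) (g := b i j)

instance matMap_linear : (matMap hdeg hpb).Linear K where
  map_smul {M N} a c := by
    funext i j
    exact (T0.map hdeg hpb).map_smul c (a i j)

variable {hdeg hpb} {M N P Q : Mat_ (T0 δ)} {t : A}

/-- The image under `F` of a point of a family. -/
def El.map (a : El M t) : El ((matMap hdeg hpb).obj M) (F.obj t) :=
  ⟨a.idx, F.map a.mor⟩

theorem El.map_pre {t' : A} (a : El M t) (p : t' ⟶ t) :
    ((a.pre p).map : El ((matMap hdeg hpb).obj M) _) = a.map.pre (F.map p) :=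
  El.mk_eq.2 (F.map_comp _ _)

/-- The image of the generic point of the `i`-th object is again generic. -/
theorem El.map_generic (i : M.ι) :
    (El.map ⟨i, 𝟙 (M.X i).obj⟩ : El ((matMap hdeg hpb).obj M) _) =
      ⟨i, 𝟙 (F.obj (M.X i).obj)⟩ :=
  El.mk_eq.2 (F.map_id _)

theorem matMap_msp (a : El M t) (b : El N t) :
    (matMap hdeg hpb).map (msp a b) = msp a.map b.map := by
  refine (place_ext (M := (matMap hdeg hpb).obj M) (N := (matMap hdeg hpb).obj N)
    (i := a.idx) (j := b.idx) ?_ ?_).symm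
  · refine (congrArg (T0.map hdeg hpb).map (place_same _ _ _)).trans ?_
    exact relMap_sp hdeg hpb _ _
  · intro i j h
    refine (congrArg (T0.map hdeg hpb).map (place_ne _ _ _ h)).trans ?_
    exact (T0.map hdeg hpb).map_zero _ _

/-- The image under `F` of a natural family of maps on points, determined by the images of the
generic points. -/
noncomputable def ElHom.map (φ : ElHom M N) :
    ElHom ((matMap hdeg hpb).obj M) ((matMap hdeg hpb).obj N) where
  app {_} a := (φ.app ⟨a.idx, 𝟙 (M.X a.idx).obj⟩).map.pre a.mor
  nat _ _ := (El.pre_pre _ _ _).symm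

theorem ElHom.map_app_map (φ : ElHom M N) (a : El M t) :
    (φ.map : ElHom ((matMap hdeg hpb).obj M) ((matMap hdeg hpb).obj N)).app a.map =
      (φ.app a).map := by
  obtain ⟨i, f⟩ := a
  refine (El.map_pre _ _).symm.trans (congrArg El.map ?_)
  exact (φ.nat _ _).symm.trans (congrArg φ.app (El.mk_pre i f))

/-- Two natural families on the image of `M` agree if they agree on the images of all points. -/
theorem ElHom.app_eq_of_map {R : Mat_ (T0 δ')} {φ ψ : ElHom ((matMap hdeg hpb).obj M) R}
    (h : ∀ (t : A) (a : El M t), φ.app a.map = ψ.app a.map) {t' : A'}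
    (a : El ((matMap hdeg hpb).obj M) t') : φ.app a = ψ.app a := by
  obtain ⟨i, f⟩ := a
  have e := El.mk_pre (M := (matMap hdeg hpb).obj M) i f
  rw [← e, φ.nat, ψ.nat]
  exact congrArg (fun x => El.pre x f) <| (congrArg φ.app (El.map_generic (M := M) i)).symm.trans
    ((h _ _).trans (congrArg ψ.app (El.map_generic (M := M) i)))

theorem ElHom.map_comp_app (φ : ElHom M N) (ψ : ElHom N P) {t' : A'}
    (a : El ((matMap hdeg hpb).obj M) t') :
    (ψ.map : ElHom ((matMap hdeg hpb).obj N) _).app (φ.map.app a) = (φ.comp ψ).map.app a :=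
  ElHom.app_eq_of_map (φ := φ.map.comp ψ.map) (fun t a => by
    rw [ElHom.map_app_map]
    change ψ.map.app (φ.map.app a.map) = _
    rw [ElHom.map_app_map, ElHom.map_app_map]
    rfl) a

/-- The structure isomorphisms of the tensor products are all of the form `gr φ`, so their images
can be computed on points. -/
theorem matMap_gr (φ : ElHom M N) :
    (matMap hdeg hpb).map (gr φ) = gr φ.map := by
  rw [gr, Functor.map_sum, gr]
  refine Finset.sum_congr rfl fun i _ => ?_
  rw [matMap_msp, El.map_generic]
  refine congrArg _ ?_
  exact (El.pre_id _).symm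

/-- The first projection `M ⊗ N → M` on points. -/
noncomputable def ElHom.fst (M N : Mat_ (T0 δ)) : ElHom (tensorObj M N) M := ⟨El.p1, El.p1_pre⟩

/-- The second projection `M ⊗ N → N` on points. -/
noncomputable def ElHom.snd (M N : Mat_ (T0 δ)) : ElHom (tensorObj M N) N := ⟨El.p2, El.p2_pre⟩

/-- If `F` preserves the terminal object, then `x × y` exists as soon as `F x` and `F y` have a
common source, i.e. as soon as `F x × F y` exists. -/
theorem PreservesPullbacks.exists_isProd (hpb : PreservesPullbacks F)
    (hF : IsTerminal (F.obj (⊤_ A))) {t : A'} {x y : A} (p : t ⟶ F.obj x) (q : t ⟶ F.obj y) :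
    ∃ (w : A) (a : w ⟶ x) (b : w ⟶ y), IsProd a b := by
  obtain ⟨w, a, b, -⟩ := hpb.exists_comm (f := terminal.from x) (g := terminal.from y)
    (p := p) (q := q) (hF.hom_ext _ _)
  exact Knop.exists_isProd a b

/-- A point of the image of `M` and a point of the image of `N` come from a point of the image of
`M ⊗ N`: the product of the two indexing objects exists in `A`, and `F` preserves it. -/
theorem El.exists_pairing (hF : IsTerminal (F.obj (⊤_ A))) {t' : A'}
    (a : El ((matMap hdeg hpb).obj M) t') (b : El ((matMap hdeg hpb).obj N) t') :
    ∃ c : El ((matMap hdeg hpb).obj (tensorObj M N)) t',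
      (ElHom.fst M N).map.app c = a ∧ (ElHom.snd M N).map.app c = b := by
  obtain ⟨i, f⟩ := a
  obtain ⟨j, g⟩ := b
  obtain ⟨w, a, b, -⟩ := hpb.exists_isProd hF f g
  have h := hasProd a b
  obtain ⟨l, hl1, hl2⟩ := (hpb.map_isProd hF (isProd_prod (M.X i).obj (N.X j).obj)).exists_lift f g
  refine ⟨⟨⟨(i, j), h⟩, l⟩, El.mk_eq.2 ?_, El.mk_eq.2 ?_⟩
  · refine Eq.trans (congrArg (fun x => l ≫ F.map x) (Category.id_comp _)) hl1
  · refine Eq.trans (congrArg (fun x => l ≫ F.map x) (Category.id_comp _)) hl2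

/-- This needs no assumption on the terminal object: `F` sends the projections of a product to a
jointly monic pair. -/
theorem El.pairing_ext {t' : A'} {a b : El ((matMap hdeg hpb).obj (tensorObj M N)) t'}
    (h1 : (ElHom.fst M N).map.app a = (ElHom.fst M N).map.app b)
    (h2 : (ElHom.snd M N).map.app a = (ElHom.snd M N).map.app b) : a = b := by
  obtain ⟨⟨⟨i, k⟩, h⟩, f⟩ := a
  obtain ⟨⟨⟨i', k'⟩, h'⟩, g⟩ := b
  obtain rfl : i = i' := (El.mk.inj h1).1
  obtain rfl : k = k' := (El.mk.inj h2).1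
  refine El.mk_eq.2 (hpb.map_jm_of_isProd (isProd_prod (M.X i).obj (N.X k).obj) _ _ ?_ ?_)
  · have := El.mk_eq.1 h1
    refine Eq.trans ?_ (this.trans ?_)
    · exact congrArg (fun x => f ≫ F.map x) (Category.id_comp _).symm
    · exact congrArg (fun x => g ≫ F.map x) (Category.id_comp _)
  · have := El.mk_eq.1 h2
    refine Eq.trans ?_ (this.trans ?_)
    · exact congrArg (fun x => f ≫ F.map x) (Category.id_comp _).symm
    · exact congrArg (fun x => g ≫ F.map x) (Category.id_comp _)

variable {t' t'' : A'}

theorem ElHom.map_congr {φ ψ : ElHom M N} (h : ∀ (t : A) (a : El M t), φ.app a = ψ.app a)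
    (a : El ((matMap hdeg hpb).obj M) t') : φ.map.app a = ψ.map.app a :=
  congrArg (fun x => El.pre (El.map x) a.mor) (h _ _)

theorem El.fst_map_pair (a : El M t) (b : El N t) :
    (ElHom.fst M N).map.app ((a.pair b).map : El ((matMap hdeg hpb).obj _) _) = a.map :=
  (ElHom.map_app_map _ _).trans (congrArg El.map (El.p1_pair a b))

theorem El.snd_map_pair (a : El M t) (b : El N t) :
    (ElHom.snd M N).map.app ((a.pair b).map : El ((matMap hdeg hpb).obj _) _) = b.map :=
  (ElHom.map_app_map _ _).trans (congrArg El.map (El.p2_pair a b))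

theorem fst_map_assoc (a : El ((matMap hdeg hpb).obj (tensorObj (tensorObj M N) P)) t') :
    (ElHom.fst M (tensorObj N P)).map.app ((assocEl M N P).hom.map.app a) =
      (ElHom.fst M N).map.app ((ElHom.fst _ P).map.app a) := by
  rw [ElHom.map_comp_app, ElHom.map_comp_app]
  exact ElHom.map_congr (fun _ _ => El.p1_pair _ _) a

theorem fst_snd_map_assoc (a : El ((matMap hdeg hpb).obj (tensorObj (tensorObj M N) P)) t') :
    (ElHom.fst N P).map.app ((ElHom.snd M _).map.app ((assocEl M N P).hom.map.app a)) =
      (ElHom.snd M N).map.app ((ElHom.fst _ P).map.app a) := by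
  rw [ElHom.map_comp_app, ElHom.map_comp_app, ElHom.map_comp_app]
  exact ElHom.map_congr (fun _ _ => (congrArg El.p1 (El.p2_pair _ _)).trans (El.p1_pair _ _)) a

theorem snd_snd_map_assoc (a : El ((matMap hdeg hpb).obj (tensorObj (tensorObj M N) P)) t') :
    (ElHom.snd N P).map.app ((ElHom.snd M _).map.app ((assocEl M N P).hom.map.app a)) =
      (ElHom.snd _ P).map.app a := by
  rw [ElHom.map_comp_app, ElHom.map_comp_app]
  exact ElHom.map_congr (fun _ _ => (congrArg El.p2 (El.p2_pair _ _)).trans (El.p2_pair _ _)) a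

theorem fst_map_braid (a : El ((matMap hdeg hpb).obj (tensorObj M N)) t') :
    (ElHom.fst N M).map.app ((braidEl M N).hom.map.app a) = (ElHom.snd M N).map.app a := by
  rw [ElHom.map_comp_app]
  exact ElHom.map_congr (fun _ _ => El.p1_pair _ _) a

theorem snd_map_braid (a : El ((matMap hdeg hpb).obj (tensorObj M N)) t') :
    (ElHom.snd N M).map.app ((braidEl M N).hom.map.app a) = (ElHom.fst M N).map.app a := by
  rw [ElHom.map_comp_app]
  exact ElHom.map_congr (fun _ _ => El.p2_pair _ _) a

variable (hF : IsTerminal (F.obj (⊤_ A)))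

/-- The point of the image of `M ⊗ N` given by a point of the image of `M` and a point of the image
of `N`; it is determined by its two projections. -/
noncomputable def El.mapPair (a : El ((matMap hdeg hpb).obj M) t')
    (b : El ((matMap hdeg hpb).obj N) t') : El ((matMap hdeg hpb).obj (tensorObj M N)) t' :=
  (El.exists_pairing hF a b).choose

theorem El.fst_mapPair (a : El ((matMap hdeg hpb).obj M) t')
    (b : El ((matMap hdeg hpb).obj N) t') : (ElHom.fst M N).map.app (a.mapPair hF b) = a :=
  (El.exists_pairing hF a b).choose_spec.1

theorem El.snd_mapPair (a : El ((matMap hdeg hpb).obj M) t')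
    (b : El ((matMap hdeg hpb).obj N) t') : (ElHom.snd M N).map.app (a.mapPair hF b) = b :=
  (El.exists_pairing hF a b).choose_spec.2

theorem El.mapPair_pre (a : El ((matMap hdeg hpb).obj M) t')
    (b : El ((matMap hdeg hpb).obj N) t') (p : t'' ⟶ t') :
    (a.mapPair hF b).pre p = (a.pre p).mapPair hF (b.pre p) :=
  El.pairing_ext (by rw [ElHom.nat, El.fst_mapPair, El.fst_mapPair])
    (by rw [ElHom.nat, El.snd_mapPair, El.snd_mapPair])

theorem El.mapPair_map (a : El M t) (b : El N t) :
    a.map.mapPair hF b.map = ((a.pair b).map : El ((matMap hdeg hpb).obj _) _) :=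
  El.pairing_ext (by rw [El.fst_mapPair, El.fst_map_pair])
    (by rw [El.snd_mapPair, El.snd_map_pair])

variable (M N)

/-- On points, the tensorator `G M ⊗ G N ≅ G (M ⊗ N)` of `G = matMap` is the pairing, which is
bijective because `F` preserves products and reflects their existence. -/
noncomputable def tensoratorEl :
    ElIso (tensorObj ((matMap hdeg hpb).obj M) ((matMap hdeg hpb).obj N))
      ((matMap hdeg hpb).obj (tensorObj M N)) where
  hom := ⟨fun a => a.p1.mapPair hF a.p2, fun a p => by
    rw [El.p1_pre, El.p2_pre, El.mapPair_pre]⟩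
  inv := ⟨fun a => ((ElHom.fst M N).map.app a).pair ((ElHom.snd M N).map.app a), fun a p => by
    rw [ElHom.nat, ElHom.nat, El.pair_pre]⟩
  hom_inv t a := by simp only [El.fst_mapPair, El.snd_mapPair, El.pair_eta]
  inv_hom t a := El.pairing_ext (by simp only [El.p1_pair, El.p2_pair, El.fst_mapPair])
    (by simp only [El.p1_pair, El.p2_pair, El.snd_mapPair])

variable (hdeg hpb) in
/-- The image of the unit is the unit, because `F 1` is terminal. -/
noncomputable def unitEl : ElIso (tensorUnit δ') ((matMap hdeg hpb).obj (tensorUnit δ)) where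
  hom := ⟨fun {t} _ => ⟨PUnit.unit, hF.from t⟩, fun _ _ => El.mk_eq.2 (hF.hom_ext _ _)⟩
  inv := ⟨fun {t} _ => El.unit t, fun a p => (El.eq_unit _).symm⟩
  hom_inv t a := (El.eq_unit _).symm
  inv_hom t a := by
    obtain ⟨⟨⟩, f⟩ := a
    exact El.mk_eq.2 (hF.hom_ext _ _)

variable {M N}

/-- On generating morphisms, either the product of the sources exists and is preserved, or it exists
neither in `A` nor, after applying `F`, in `A'`, and both sides vanish. -/
theorem tensorator_nat (f : M ⟶ N) (g : P ⟶ Q) :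
    tensorHom ((matMap hdeg hpb).map f) ((matMap hdeg hpb).map g) ≫
        (tensoratorEl N Q hF).iso.hom =
      (tensoratorEl M P hF).iso.hom ≫ (matMap hdeg hpb).map (tensorHom f g) := by
  induction f using msp_induction with
  | zero => simp only [zero_tensorHom, Functor.map_zero, zero_comp, comp_zero]
  | add x y hx hy =>
    simp only [add_tensorHom, Functor.map_add, Preadditive.add_comp, Preadditive.comp_add, hx, hy]
  | smul c x hx =>
    simp only [smul_tensorHom, Functor.map_smul, Linear.smul_comp, Linear.comp_smul, hx]
  | h t a b =>
  induction g using msp_induction with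
  | zero => simp only [tensorHom_zero, Functor.map_zero, zero_comp, comp_zero]
  | add x y hx hy =>
    simp only [tensorHom_add, Functor.map_add, Preadditive.add_comp, Preadditive.comp_add, hx, hy]
  | smul c x hx =>
    simp only [tensorHom_smul, Functor.map_smul, Linear.smul_comp, Linear.comp_smul, hx]
  | h t' c d =>
    rw [matMap_msp, matMap_msp]
    by_cases H : ∃ (s : A) (_ : s ⟶ t) (_ : s ⟶ t'), True
    · obtain ⟨s, f₁, f₂, -⟩ := H
      obtain ⟨W, p, q, hW⟩ := exists_isProd f₁ f₂
      rw [msp_tensor _ _ _ _ hW, msp_tensor _ _ _ _ (hpb.map_isProd hF hW), matMap_msp,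
        msp_iso_hom, iso_hom_msp]
      simp only [tensoratorEl, El.p1_pair, El.p2_pair, ← El.map_pre, El.mapPair_map,
        El.fst_map_pair, El.snd_map_pair]
    · rw [msp_tensor_zero a b c d fun s f g => H ⟨s, f, g, trivial⟩, Functor.map_zero, comp_zero,
        msp_tensor_zero, zero_comp]
      intro s f g
      obtain ⟨W, p, q, -⟩ := hpb.exists_isProd hF f g
      exact H ⟨W, p, q, trivial⟩

/-- If `F` preserves the terminal object, `matMap` is monoidal. -/
noncomputable def matMapCoreMonoidal : (matMap hdeg hpb).CoreMonoidal where
  εIso := (unitEl hdeg hpb hF).iso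
  μIso M N := (tensoratorEl M N hF).iso
  μIso_hom_natural_left f X := by
    have := tensorator_nat (hdeg := hdeg) (hpb := hpb) hF f (𝟙 X)
    rwa [(matMap hdeg hpb).map_id] at this
  μIso_hom_natural_right X f := by
    have := tensorator_nat (hdeg := hdeg) (hpb := hpb) hF (𝟙 X) f
    rwa [(matMap hdeg hpb).map_id] at this
  associativity M N P := by
    change tensorHom (gr _) (𝟙 _) ≫ gr _ ≫ (matMap hdeg hpb).map (gr _) =
      gr _ ≫ tensorHom (𝟙 _) (gr _) ≫ gr _
    rw [← gr_ElHom_id, ← gr_ElHom_id, gr_tensor, gr_tensor, matMap_gr, gr_comp, gr_comp, gr_comp,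
      gr_comp]
    refine gr_congr fun t a => ?_
    simp only [ElHom.comp, ElHom.prod, ElHom.id, assocEl, tensoratorEl, El.p1_pair, El.p2_pair]
    refine El.pairing_ext ((fst_map_assoc _).trans ?_)
      (El.pairing_ext ((fst_snd_map_assoc _).trans ?_) ((snd_snd_map_assoc _).trans ?_)) <;>
    simp only [El.fst_mapPair, El.snd_mapPair]
  left_unitality M := by
    change gr _ = tensorHom (gr _) (𝟙 _) ≫ gr _ ≫ (matMap hdeg hpb).map (gr _)
    rw [← gr_ElHom_id, gr_tensor, matMap_gr, gr_comp, gr_comp]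
    refine gr_congr fun t a => ?_
    exact (El.p2_pair _ _).symm.trans (El.snd_mapPair hF _ _).symm
  right_unitality M := by
    change gr _ = tensorHom (𝟙 _) (gr _) ≫ gr _ ≫ (matMap hdeg hpb).map (gr _)
    rw [← gr_ElHom_id, gr_tensor, matMap_gr, gr_comp, gr_comp]
    refine gr_congr fun t a => ?_
    exact (El.p1_pair _ _).symm.trans (El.fst_mapPair hF _ _).symm

/-- If `F` preserves the terminal object, `matMap` is symmetric monoidal. -/
noncomputable abbrev matMapBraided : (matMap hdeg hpb).Braided where
  toMonoidal := (matMapCoreMonoidal hF).toMonoidal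
  braided M N := by
    change gr _ ≫ (matMap hdeg hpb).map (gr _) = gr _ ≫ gr _
    rw [matMap_gr, gr_comp, gr_comp]
    refine gr_congr fun t a => ?_
    refine El.pairing_ext ((fst_map_braid _).trans ?_) ((snd_map_braid _).trans ?_) <;>
    simp only [ElHom.comp, tensoratorEl, braidEl, El.fst_mapPair, El.snd_mapPair, El.p1_pair,
      El.p2_pair]

end MatBraided

/-! ### The extension to formal direct factors -/

section KaroubiBraided

open MonoidalCategory Idempotents Functor.LaxMonoidal

variable {C : Type u} [Category.{v} C] {D : Type u'} [Category.{v'} D] (G : C ⥤ D)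

/-- The image of a formal direct factor. -/
abbrev karoubiObj (X : Karoubi C) : Karoubi D :=
  ⟨G.obj X.X, G.map X.p, (G.map_comp _ _).symm.trans (congrArg G.map X.idem)⟩

/-- The extension of a functor to formal direct factors; it is
`(functorExtension₂ C D).obj G`, written so that its values on objects unfold at reducible transparency. -/
abbrev karoubiMap : Karoubi C ⥤ Karoubi D where
  obj := karoubiObj G
  map f := ⟨G.map f.f, by
    change G.map _ ≫ G.map _ ≫ G.map _ = _
    rw [← G.map_comp, ← G.map_comp, f.comm]⟩
  map_id _ := rfl
  map_comp _ _ := Karoubi.hom_ext _ _ (G.map_comp _ _)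

/-- The functor `karoubiMap G` extends `G`. -/
def karoubiMapIso : toKaroubi C ⋙ karoubiMap G ≅ G ⋙ toKaroubi D :=
  NatIso.ofComponents
    (fun X =>
      { hom := { f := 𝟙 (G.obj X) }
        inv := { f := 𝟙 (G.obj X) } })
    fun _ => Karoubi.hom_ext _ _ (by simp)

theorem karoubiMap_additive [Preadditive C] [Preadditive D] [G.Additive] :
    (karoubiMap G).Additive where
  map_add := Karoubi.hom_ext _ _ (G.map_add)

theorem karoubiMap_linear {R : Type w} [Semiring R] [Preadditive C] [Preadditive D] [Linear R C]
    [Linear R D] [G.Linear R] : (karoubiMap G).Linear R where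
  map_smul f r := Karoubi.hom_ext _ _ (G.map_smul r f.f)

theorem karoubiMap_klift {X Y : Karoubi C} (f : X.X ⟶ Y.X) (h : X.p ≫ f = f ≫ Y.p) :
    (karoubiMap G).map (klift f h) =
      klift (X := karoubiObj G X) (Y := karoubiObj G Y) (G.map f)
        ((G.map_comp _ _).symm.trans ((congrArg G.map h).trans (G.map_comp _ _))) :=
  Karoubi.hom_ext _ _ (G.map_comp _ _)

variable [MonoidalCategory C] [MonoidalCategory D]

section

variable [G.Monoidal]

theorem karoubiMap_μ_comm (X Y : Karoubi C) :
    (ktensor (karoubiObj G X) (karoubiObj G Y)).p ≫ μ G X.X Y.X =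
      μ G X.X Y.X ≫ (karoubiObj G (ktensor X Y)).p :=
  μ_natural G X.p Y.p

theorem karoubiMap_ε_comm :
    (kunit (C := D)).p ≫ ε G = ε G ≫ (karoubiObj G (kunit (C := C))).p :=
  (Category.id_comp _).trans ((congrArg (ε G ≫ ·) (G.map_id _)).trans (Category.comp_id _)).symm

/-- The tensorator of the extension to formal direct factors. -/
abbrev karoubiMapμ (X Y : Karoubi C) :
    ktensor (karoubiObj G X) (karoubiObj G Y) ⟶ karoubiObj G (ktensor X Y) :=
  klift (μ G X.X Y.X) (karoubiMap_μ_comm G X Y)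

theorem karoubiMapμ_nat {X Y X' Y' : Karoubi C} (f : X ⟶ Y) (g : X' ⟶ Y') :
    ktensorHom ((karoubiMap G).map f) ((karoubiMap G).map g) ≫ karoubiMapμ G Y Y' =
      karoubiMapμ G X X' ≫ (karoubiMap G).map (ktensorHom f g) := by
  refine Karoubi.hom_ext _ _ <| (comp_klift_f _ _ _).trans <|
    Eq.trans ?_ (klift_comp_f _ _ _).symm
  exact μ_natural G f.f g.f

/-- The extension of a monoidal functor to formal direct factors is monoidal. -/
def karoubiMapCoreMonoidal : (karoubiMap G).CoreMonoidal where
  εIso := kliftIso (X := kunit) (Y := karoubiObj G kunit) (Functor.Monoidal.εIso G)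
    (karoubiMap_ε_comm G)
  μIso X Y := kliftIso (X := ktensor (karoubiObj G X) (karoubiObj G Y))
    (Y := karoubiObj G (ktensor X Y)) (Functor.Monoidal.μIso G X.X Y.X)
    (karoubiMap_μ_comm G X Y)
  μIso_hom_natural_left f X := by
    have := karoubiMapμ_nat G f (𝟙 X)
    rwa [(karoubiMap G).map_id] at this
  μIso_hom_natural_right X f := by
    have := karoubiMapμ_nat G (𝟙 X) f
    rwa [(karoubiMap G).map_id] at this
  associativity X Y Z := by
    change ktensorHom (karoubiMapμ G X Y) (𝟙 _) ≫ karoubiMapμ G (ktensor X Y) Z ≫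
        (karoubiMap G).map (kassoc X Y Z) =
      kassoc (karoubiObj G X) (karoubiObj G Y) (karoubiObj G Z) ≫
        ktensorHom (𝟙 _) (karoubiMapμ G Y Z) ≫ karoubiMapμ G X (ktensor Y Z)
    rw [← klift_id, ← klift_id, klift_tensor, klift_tensor, karoubiMap_klift, klift_comp,
      klift_comp, klift_comp, klift_comp]
    refine klift_congr ?_ _ _
    rw [tensorHom_id, id_tensorHom]
    exact associativity G X.X Y.X Z.X
  left_unitality X := by
    change kleft (karoubiObj G X) =
      ktensorHom (klift (X := kunit) (Y := karoubiObj G kunit) (ε G) (karoubiMap_ε_comm G))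
        (𝟙 _) ≫ karoubiMapμ G kunit X ≫ (karoubiMap G).map (kleft X)
    rw [← klift_id, klift_tensor, karoubiMap_klift, klift_comp, klift_comp]
    refine klift_congr ?_ _ _
    rw [tensorHom_id]
    exact left_unitality G X.X
  right_unitality X := by
    change kright (karoubiObj G X) =
      ktensorHom (𝟙 _)
        (klift (X := kunit) (Y := karoubiObj G kunit) (ε G) (karoubiMap_ε_comm G)) ≫
          karoubiMapμ G X kunit ≫ (karoubiMap G).map (kright X)
    rw [← klift_id, klift_tensor, karoubiMap_klift, klift_comp, klift_comp]
    refine klift_congr ?_ _ _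
    rw [id_tensorHom]
    exact right_unitality G X.X

end

/-- The extension of a symmetric monoidal functor to formal direct factors is symmetric
monoidal. -/
abbrev karoubiMapBraided [SymmetricCategory C] [SymmetricCategory D] [G.Braided] :
    (karoubiMap G).Braided where
  toMonoidal := (karoubiMapCoreMonoidal G).toMonoidal
  braided X Y := by
    change karoubiMapμ G X Y ≫ (karoubiMap G).map (kbraid X Y) =
      kbraid (karoubiObj G X) (karoubiObj G Y) ≫ karoubiMapμ G Y X
    rw [karoubiMap_klift, klift_comp, klift_comp]
    exact klift_congr (Functor.LaxBraided.braided X.X Y.X) _ _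

end KaroubiBraided

/-! ### Lifting monoidal structures along fully faithful functors -/

section Lifting

open MonoidalCategory Functor.LaxMonoidal Functor.OplaxMonoidal Functor.Monoidal

variable {C : Type*} [Category* C] [MonoidalCategory C] {D : Type*} [Category* D]
  [MonoidalCategory D] {E : Type*} [Category* E] [MonoidalCategory E]
  (H : C ⥤ D) (J : D ⥤ E) [J.Full] [J.Faithful]

/-- A functor whose composite with a fully faithful monoidal functor is monoidal is monoidal. -/
noncomputable def coreMonoidalOfComp [J.Monoidal] [(H ⋙ J).Monoidal] : H.CoreMonoidal where
  εIso := J.preimageIso ((εIso J).symm ≪≫ εIso (H ⋙ J))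
  μIso X Y := J.preimageIso ((μIso J _ _).symm ≪≫ μIso (H ⋙ J) X Y)
  μIso_hom_natural_left f X' := J.map_injective (by
    have := μ_natural_left (H ⋙ J) f X'
    simp only [Functor.comp_map, Functor.comp_obj] at this
    simp only [Functor.map_comp, Functor.preimageIso_hom, Functor.map_preimage, Iso.trans_hom,
      Iso.symm_hom, μIso_inv, μIso_hom, map_whiskerRight J, Category.assoc, μ_δ_assoc, this])
  μIso_hom_natural_right X' f := J.map_injective (by
    have := μ_natural_right (H ⋙ J) X' f
    simp only [Functor.comp_map, Functor.comp_obj] at this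
    simp only [Functor.map_comp, Functor.preimageIso_hom, Functor.map_preimage, Iso.trans_hom,
      Iso.symm_hom, μIso_inv, μIso_hom, map_whiskerLeft J, Category.assoc, μ_δ_assoc, this])
  associativity X Y Z := J.map_injective (by
    have := Functor.LaxMonoidal.associativity (H ⋙ J) X Y Z
    simp only [Functor.comp_map, Functor.comp_obj] at this
    simp only [Functor.map_comp, Functor.preimageIso_hom, Functor.map_preimage, Iso.trans_hom,
      Iso.symm_hom, μIso_inv, μIso_hom, map_whiskerLeft J, map_whiskerRight J, Category.assoc,
      μ_δ_assoc, this, map_associator J, comp_whiskerRight, MonoidalCategory.whiskerLeft_comp,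
      whiskerLeft_μ_δ_assoc])
  left_unitality X := J.map_injective (by
    have := Functor.LaxMonoidal.left_unitality (H ⋙ J) X
    simp only [Functor.comp_map, Functor.comp_obj] at this
    simp only [Functor.map_comp, Functor.preimageIso_hom, Functor.map_preimage, Iso.trans_hom,
      Iso.symm_hom, μIso_inv, μIso_hom, εIso_inv, εIso_hom, map_whiskerRight J, Category.assoc,
      μ_δ_assoc, this, map_leftUnitor J, comp_whiskerRight])
  right_unitality X := J.map_injective (by
    have := Functor.LaxMonoidal.right_unitality (H ⋙ J) X
    simp only [Functor.comp_map, Functor.comp_obj] at this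
    simp only [Functor.map_comp, Functor.preimageIso_hom, Functor.map_preimage, Iso.trans_hom,
      Iso.symm_hom, μIso_inv, μIso_hom, εIso_inv, εIso_hom, map_whiskerLeft J, Category.assoc,
      μ_δ_assoc, this, map_rightUnitor J, MonoidalCategory.whiskerLeft_comp])

/-- A functor whose composite with a fully faithful braided functor is braided is braided. -/
noncomputable abbrev braidedOfComp [BraidedCategory C] [BraidedCategory D] [BraidedCategory E]
    [J.Braided] [(H ⋙ J).Braided] : H.Braided where
  toMonoidal := (coreMonoidalOfComp H J).toMonoidal
  braided X Y := J.map_injective (by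
    have := Functor.LaxBraided.braided (F := H ⋙ J) X Y
    simp only [Functor.comp_map, Functor.comp_obj] at this
    change J.map (J.preimage _ ≫ _) = J.map (_ ≫ J.preimage _)
    simp only [Functor.map_comp, Functor.map_preimage, Iso.trans_hom, Iso.symm_hom, μIso_inv,
      μIso_hom, Category.assoc, this, Functor.map_braiding J, μ_δ_assoc])

/-- A functor isomorphic to a braided functor is braided. -/
abbrev braidedOfIso [BraidedCategory C] [BraidedCategory D] {H H' : C ⥤ D} [H.Braided]
    (i : H ≅ H') : H'.Braided :=
  letI := transport i
  have := natTransIsMonoidal_of_transport i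
  letI := Functor.LaxBraided.ofNatIso i
  { braided := fun X Y => Functor.LaxBraided.braided X Y }

end Lifting

/-! ### The tensor category of relations and its envelope -/

section SkeletalBraided

variable {K : Type w} [Field K] {A : Type u} [Category.{v} A] {A' : Type u'} [Category.{v'} A']
  [RegularCategory A] [RegularCategory A'] {F : A ⥤ A'} {δ : DegreeFunction K A}
  {δ' : DegreeFunction K A'} (hdeg : PreservesDegree δ δ' F) (hpb : PreservesPullbacks F)

/-- The functor `matMap` extends `T0.map`. -/
noncomputable def matMapIso : Mat_.embedding (T0 δ) ⋙ matMap hdeg hpb ≅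
    T0.map hdeg hpb ⋙ Mat_.embedding (T0 δ') :=
  NatIso.ofComponents (fun _ => Iso.refl _) fun _ =>
    (Category.comp_id _).trans (Category.id_comp _).symm

/-- The embedding of `T⁰(A, δ)` in its additive envelope is compatible with the symmetries. -/
noncomputable abbrev embBraided [HasBinaryProducts A] : (Mat_.embedding (T0 δ)).Braided where
  braided X Y := by
    -- the braiding of `T0 δ` is by definition the preimage of the morphism below
    have := (Mat_.embedding (T0 δ)).map_preimage
      ((Functor.Monoidal.μIso (Mat_.embedding (T0 δ)) X Y).symm ≪≫ BraidedCategory.braiding _ _ ≪≫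
        Functor.Monoidal.μIso (Mat_.embedding (T0 δ)) Y X).hom
    refine (congrArg (Functor.LaxMonoidal.μ (Mat_.embedding (T0 δ)) X Y ≫ ·) this).trans ?_
    simp

/-- If products exist and `F` preserves the terminal object, `T0.map` is symmetric monoidal. -/
noncomputable abbrev T0.mapBraided [HasBinaryProducts A] [HasBinaryProducts A']
    (hF : IsTerminal (F.obj (⊤_ A))) : (T0.map hdeg hpb).Braided :=
  letI := embBraided (δ := δ)
  letI := embBraided (δ := δ')
  letI : (matMap hdeg hpb).Braided := matMapBraided hF
  letI := braidedOfIso (matMapIso hdeg hpb)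
  braidedOfComp _ (Mat_.embedding (T0 δ'))

/-- The extension of `T0.map` to the additive Karoubi envelopes: first to finite families, then to
formal direct factors. -/
noncomputable abbrev T.map : T δ ⥤ T δ' := karoubiMap (matMap hdeg hpb)

/-- The functor `T.map` extends `T0.map`. -/
noncomputable def T.mapIso : toT δ ⋙ T.map hdeg hpb ≅ T0.map hdeg hpb ⋙ toT δ' :=
  calc toT δ ⋙ T.map hdeg hpb
    _ ≅ Mat_.embedding (T0 δ) ⋙ Idempotents.toKaroubi _ ⋙ T.map hdeg hpb :=
      Functor.associator _ _ _
    _ ≅ Mat_.embedding (T0 δ) ⋙ matMap hdeg hpb ⋙ Idempotents.toKaroubi _ :=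
      Functor.isoWhiskerLeft _ (karoubiMapIso _)
    _ ≅ (Mat_.embedding (T0 δ) ⋙ matMap hdeg hpb) ⋙ Idempotents.toKaroubi _ :=
      (Functor.associator _ _ _).symm
    _ ≅ (T0.map hdeg hpb ⋙ Mat_.embedding (T0 δ')) ⋙ Idempotents.toKaroubi _ :=
      Functor.isoWhiskerRight (matMapIso hdeg hpb) _
    _ ≅ T0.map hdeg hpb ⋙ toT δ' := Functor.associator _ _ _

end SkeletalBraided

end Knop

theorem mainTheorem1 {K : Type*} [Field K]
    {A : Type*} [Category* A] [Knop.RegularCategory A]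
    {A' : Type*} [Category* A'] [Knop.RegularCategory A']
    (δ : Knop.DegreeFunction K A) (δ' : Knop.DegreeFunction K A') (F : A ⥤ A')
    (hdeg : Knop.PreservesDegree δ δ' F) (hpb : Knop.PreservesPullbacks F) :
    -- preserving the terminal object is equivalent to preserving all existing finite limits
    (Nonempty (IsTerminal (F.obj (⊤_ A))) ↔ PreservesFiniteLimits F) ∧
    -- the functor `Fbar : T⁰(A, δ) ⥤ T⁰(A', δ')`, `[x] ↦ [F x]`, `⟨r⟩ ↦ ⟨F r⟩`
    ∃ Fbar : Knop.T0 δ ⥤ Knop.T0 δ',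
      Fbar.Additive ∧ Functor.Linear K Fbar ∧
      (∃ hobj : ∀ x : A, Fbar.obj (Knop.T0.of x) = Knop.T0.of (F.obj x),
        ∀ {r x y : A} (f : r ⟶ x) (g : r ⟶ y) (h : Knop.JM f g),
          ∃ h' : Knop.JM (F.map f) (F.map g),
            Fbar.map (Knop.T0.rel (Knop.Rel.mk f g h)) =
              eqToHom (hobj x) ≫ Knop.T0.rel (Knop.Rel.mk (F.map f) (F.map g) h') ≫
                eqToHom (hobj y).symm) ∧
      Nonempty (F ⋙ Knop.Γ δ' ≅ Knop.Γ δ ⋙ Fbar) ∧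
      -- if all `[x] ⊗ [y]` exist in the skeletal categories, `Fbar` itself is symmetric monoidal
      (∀ [HasBinaryProducts A] [HasBinaryProducts A'],
        Nonempty (IsTerminal (F.obj (⊤_ A))) → Nonempty Fbar.Braided) ∧
      -- the extension of `Fbar` to the additive Karoubi envelopes
      ∃ Fhat : Knop.T δ ⥤ Knop.T δ',
        Fhat.Additive ∧ Functor.Linear K Fhat ∧
        Nonempty (Knop.toT δ ⋙ Fhat ≅ Fbar ⋙ Knop.toT δ') ∧
        (Nonempty (IsTerminal (F.obj (⊤_ A))) → Nonempty Fhat.Braided) :=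
  ⟨hpb.terminal_iff, Knop.T0.map hdeg hpb, inferInstance, inferInstance,
    -- `hobj` holds by definition, so both `eqToHom` are identities
    ⟨fun _ => rfl, fun f g h => ⟨hpb.map_jm h, (Knop.T0.map_rel hdeg hpb f g h).trans
      ((Category.id_comp _).trans (Category.comp_id _)).symm⟩⟩,
    ⟨Knop.T0.mapΓIso hdeg hpb⟩,
    fun ⟨hF⟩ => ⟨Knop.T0.mapBraided hdeg hpb hF⟩,
    Knop.T.map hdeg hpb, Knop.karoubiMap_additive _, Knop.karoubiMap_linear _,
    ⟨Knop.T.mapIso hdeg hpb⟩,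
    fun ⟨hF⟩ =>
      letI : (Knop.matMap hdeg hpb).Braided := Knop.matMapBraided hF
      ⟨Knop.karoubiMapBraided (Knop.matMap hdeg hpb)⟩⟩
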